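/- Let $n\ge 0$ and let a chain of $2n$ spins of size one have the standard basis $|s\rangle$, $s\in\{+1,0,-1\}^{2n}$, where $+1,0,-1$ are read as a step up, a flat step and a step down. A non-negative walk from height $p$ to height $q$ on $\ell$ steps is an $s\in\{+1,0,-1\}^{\ell}$ with $p+s_1+\dots+s_j\ge 0$ for all $0\le j\le\ell$ and $p+s_1+\dots+s_\ell=q$; let $M_{\ell,p,q}$ be the number of them, and $N=M_{2n,0,0}$. The Motzkin state is $$|\mathcal M_{2n}\rangle=\frac1{\sqrt N}\sum_{s}|s\rangle,$$ the sum being over the non-negative walks from $0$ to $0$ on $2n$ steps. For $0\le n_1\le 2n$ let $\rho_{\rm cut}=\mathrm{Tr}_{1\cdots n_1}|\mathcal M_{2n}\rangle\langle\mathcal M_{2n}|$ be its reduced density matrix on the last $2n-n_1$ spins, and put $$S_{\rm cut}=-\mathrm{Tr}[\rho_{\rm cut}\log\rho_{\rm cut}],\qquad S^{\kappa}_{\rm cut}=\frac1{1-\kappa}\log\mathrm{Tr}\big[\rho_{\rm cut}^{\kappa}\big]\quad(\kappa>0,\ \kappa\ne1),$$ in nats (natural logarithm); the same quantities in bits are defined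 with $\log_2$ in place of $\log$. Let $b=\min(n_1,2n-n_1)$ and $p_m=M_{n_1,0,m}M_{2n-n_1,m,0}/N$. Write $X\approx Y$ if $X-Y\to0$ as $\min(n_1,2n-n_1)\to\infty$, that is, if for every $\varepsilon>0$ there is a $K$ such that $|X-Y|<\varepsilon$ for all $n,n_1$ with $n_1\ge K$ and $2n-n_1\ge K$. Then: 1. For all $n$ and $0\le n_1\le 2n$, in nats, $S_{\rm cut}=-\sum_{m=0}^{b}p_m\log p_m$. Moreover $$S_{\rm cut}\approx\frac12\log\left[\frac{n_1(2n-n_1)}{n}\right]+\gamma-\frac12+\frac12\log\frac{2\pi}{3}\quad\text{nats},$$ $$S_{\rm cut}\approx\frac12\log_2\left[\frac{n_1(2n-n_1)}{n}\right]+\Big(\gamma-\frac12\Big)\log_2 e+\frac12\log_2\frac{2\pi}{3}\quad\text{bits},$$ where $\gamma$ is Euler's constant. 2. For every fixed $\kappa>0$ with $\kappa\ne1$: for all $n$ and $0\le n_1\le2n$, in nats, $S^{\kappa}_{\rm cut}=\frac1{1-\kappa}\log\sum_{m=0}^{b}p_m^{\kappa}$. Moreover $$S^{\kappa}_{\rm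 cut}\approx\frac12\log\left[\frac{n_1(2n-n_1)}{n}\right]+f(\kappa)\quad\text{nats},\qquad S^{\kappa}_{\rm cut}\approx\frac12\log_2\left[\frac{n_1(2n-n_1)}{n}\right]+f(\kappa)\log_2 e\quad\text{bits},$$ $$f(\kappa)=\frac{\log\Gamma(\kappa+\frac12)}{1-\kappa}-\frac1{2(1-\kappa)}\Big\{(1+2\kappa)\log\kappa+\kappa\log\frac{\pi}{24}+\log 6\Big\}.$$ 3. In particular, for $n_1=n$, the half-chain entropy in bits satisfies $$S_{\rm cut}-\Big(\frac12\log_2 n+\Big(\gamma-\frac12\Big)\log_2e+\frac12\log_2\frac{2\pi}{3}\Big)\to0\qquad(n\to\infty).$$ -/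

import Mathlib

open scoped Matrix

/-- Height of the walk `s` after its first `j` steps, relative to its starting point.
A basis state of `ℓ` spins of size one is a function `s : Fin ℓ → SignType`: the values `1`, `0`, `-1`
stand for a step up `u`, a flat step `0` and a step down `d`. -/
def height {ℓ : ℕ} (s : Fin ℓ → SignType) (j : ℕ) : ℤ :=
  ∑ i : Fin ℓ with i.val < j, (s i : ℤ)

/-- `s` is a non-negative walk on `ℓ` steps that starts at height `p` and ends at height `q`. -/
def IsMotzkinWalk {ℓ : ℕ} (p q : ℕ) (s : Fin ℓ → SignType) : Prop :=
  (∀ j ≤ ℓ, 0 ≤ (p : ℤ) + height s j) ∧ (p : ℤ) + height s ℓ = q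

instance {ℓ : ℕ} (p q : ℕ) (s : Fin ℓ → SignType) : Decidable (IsMotzkinWalk p q s) :=
  inferInstanceAs (Decidable (_ ∧ _))

/-- The number `M_{ℓ,p,q}` of non-negative walks on `ℓ` steps from height `p` to height `q`. -/
def motzkinCount (ℓ p q : ℕ) : ℕ :=
  (Finset.univ.filter fun s : Fin ℓ → SignType => IsMotzkinWalk p q s).card

noncomputable section

/-- The Motzkin state on `ℓ` spins: the normalized uniform superposition of all Motzkin walks
(from height `0` to height `0`), by its amplitudes in the standard basis of `(ℂ³)^{⊗ ℓ}`. -/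
def motzkinState (ℓ : ℕ) : (Fin ℓ → SignType) → ℂ := fun s =>
  if IsMotzkinWalk 0 0 s then ((1 / Real.sqrt (motzkinCount ℓ 0 0) : ℝ) : ℂ) else 0

/-- The density matrix `|ψ⟩⟨ψ|`. -/
def pureDensity {ι : Type*} (ψ : ι → ℂ) : Matrix ι ι ℂ :=
  Matrix.vecMulVec ψ (star ψ)

/-- The partial trace over the first `a` of `a + b` spins. -/
def partialTraceFirst (a b : ℕ)
    (ρ : Matrix (Fin (a + b) → SignType) (Fin (a + b) → SignType) ℂ) :
    Matrix (Fin b → SignType) (Fin b → SignType) ℂ :=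
  fun t t' => ∑ s : Fin a → SignType, ρ (Fin.append s t) (Fin.append s t')

/-- The reduced density matrix of the Motzkin state on `a + b` spins for the cut between
the first `a` and the last `b` spins. -/
def rhoCut (a b : ℕ) : Matrix (Fin b → SignType) (Fin b → SignType) ℂ :=
  partialTraceFirst a b (pureDensity (motzkinState (a + b)))

/-- The reduced density matrix is Hermitian, so that the functional calculus applies to it. -/
theorem rhoCut_isHermitian (a b : ℕ) : (rhoCut a b).IsHermitian := by
  ext t t'
  simp [rhoCut, partialTraceFirst, pureDensity, Matrix.vecMulVec_apply, mul_comm]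

section Entropy

variable {ι : Type*} [Fintype ι] [DecidableEq ι]

/-- The von Neumann entropy `-Tr (ρ log ρ)` in nats. The logarithm of the matrix is taken by
the functional calculus; the eigenvalue `0` contributes `0 * log 0 = 0`. -/
def vonNeumannNats (ρ : Matrix ι ι ℂ) : ℝ :=
  -(ρ * cfc Real.log ρ).trace.re

/-- The von Neumann entropy `-Tr (ρ log₂ ρ)` in bits. -/
def vonNeumannBits (ρ : Matrix ι ι ℂ) : ℝ :=
  -(ρ * cfc (Real.logb 2) ρ).trace.re

/-- The Rényi entropy `(1 - κ)⁻¹ log Tr (ρ^κ)` in nats. -/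
def renyiNats (κ : ℝ) (ρ : Matrix ι ι ℂ) : ℝ :=
  1 / (1 - κ) * Real.log (cfc (fun x : ℝ => x ^ κ) ρ).trace.re

/-- The Rényi entropy `(1 - κ)⁻¹ log₂ Tr (ρ^κ)` in bits. -/
def renyiBits (κ : ℝ) (ρ : Matrix ι ι ℂ) : ℝ :=
  1 / (1 - κ) * Real.logb 2 (cfc (fun x : ℝ => x ^ κ) ρ).trace.re

end Entropy

/-- The Schmidt probabilities `p_m = M_{a,0,m} M_{b,m,0} / N`, where `N` is the number of Motzkin
walks on `a + b` steps. -/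
def schmidtProb (a b m : ℕ) : ℝ :=
  (motzkinCount a 0 m : ℝ) * motzkinCount b m 0 / motzkinCount (a + b) 0 0

/-- The function `f` of the Rényi formula. -/
def renyiConst (κ : ℝ) : ℝ :=
  Real.log (Real.Gamma (κ + 1 / 2)) / (1 - κ)
    - 1 / (2 * (1 - κ)) *
      ((1 + 2 * κ) * Real.log κ + κ * Real.log (Real.pi / 24) + Real.log 6)

/-- `S n₁ n₂ ≈ A n n₁` for the cuts of chains of length `2n = n₁ + n₂` with `n₁` and
`n₂ = 2n - n₁` large: the difference tends to `0` as `min n₁ n₂` tends to infinity. -/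
def CutAsymptotic (S A : ℕ → ℕ → ℝ) : Prop :=
  ∀ ε : ℝ, 0 < ε → ∃ K : ℕ, ∀ n n₁ n₂ : ℕ, n₁ + n₂ = 2 * n → K ≤ n₁ → K ≤ n₂ →
    |S n₁ n₂ - A n n₁| < ε

end

/-!
The height of a uniformly random Motzkin walk at the cut, rescaled by `s` with
`s² = σ² n₁ n₂ / (n₁ + n₂)` and `σ² = 2/3` the variance of a step, has the Maxwell density
`√(2/π) x² exp (-x²/2)` in the limit. The entropies at the cut are those of the distribution of this
height, hence equal `log s` plus the differential entropy of the Maxwell distribution, up to `o(1)`.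

The reduced density matrix is a combination of mutually orthogonal rank-one matrices, one for each
height `m` (`rhoCut_eq_sum`), so that the trace of `f ρ` is `∑ f (p_m)` whenever `f 0 = 0`
(`trace_cfc_rhoCut`).

For the asymptotics, let `J(A, k) = ∫₀^π φ(θ)^A cos (kθ) dθ`, where `φ` is the characteristic
function of a step. The reflection principle and an integration by parts show that
`M_{ℓ,0,m}` is proportional to `(m + 1) J(ℓ + 1, m + 1)` (`motzkinCount_eq_cosCoeff`). Hence `p_m` is
proportional to `k² J(A, k) J(B, k)` with `k = m + 1`, `A = n₁ + 1`, `B = n₂ + 1`, and the normalizing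
factor need not be computed, as the `p_m` sum to `1`. Dominated convergence in the
integral `J` gives a local limit theorem that is uniform in `k` (`cosCoeff_local_limit`). A Gaussian
bound `√A J(A, k) ≤ C exp (-k²/(8A))`, uniform in `A` and `k` (`exists_sqrt_mul_cosCoeff_le`), follows
from Chernoff's bound for the tail of the free walk, because `J(A, k)` decreases along `k, k + 2, …`.

A sum over heights is the integral of a step function on the scale `s`. With the two facts above,
dominated convergence along `n₁, n₂ → ∞` yields the limit of `∫ F` of the rescaled density for
`F y = y ^ κ` and `F y = -y log y` (`RpowBounded.tendsto_integral`). The limits are Gamma integrals;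
for the von Neumann entropy the derivative of `Γ` at `3/2` enters, and with it Euler's constant.
-/

/-! ### Non-negative walks -/

theorem height_append {a b : ℕ} (s : Fin a → SignType) (t : Fin b → SignType) (j : ℕ) :
    height (Fin.append s t) j = height s j + height t (j - a) := by
  unfold height
  rw [Finset.sum_filter, Finset.sum_filter, Finset.sum_filter, Fin.sum_univ_add]
  congr 1
  · simp
  · refine Finset.sum_congr rfl fun i _ => ?_
    have : (a + (i : ℕ) < j) ↔ ((i : ℕ) < j - a) := by omega
    simp [this]

theorem height_of_le {a : ℕ} (s : Fin a → SignType) {j : ℕ} (h : a ≤ j) :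
    height s j = height s a := by
  unfold height
  congr 1
  ext i
  simp [lt_of_lt_of_le i.isLt h]

theorem height_zero {a : ℕ} (s : Fin a → SignType) : height s 0 = 0 := by
  simp [height]

theorem abs_height_le {a : ℕ} (s : Fin a → SignType) (j : ℕ) : |height s j| ≤ a := by
  unfold height
  refine (Finset.abs_sum_le_sum_abs _ _).trans ?_
  refine (Finset.sum_le_card_nsmul _ _ 1 fun i _ => ?_).trans ?_
  · cases s i <;> decide
  · have := Finset.card_filter_le (Finset.univ : Finset (Fin a)) (fun i => i.val < j)
    simp only [Finset.card_univ, Fintype.card_fin] at this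
    simpa using this

/-- A non-negative walk on `a + b` steps is a non-negative walk on `a` steps to some height `r`
followed by one on `b` steps from `r`. -/
theorem isMotzkinWalk_append {a b p q : ℕ} (s : Fin a → SignType) (t : Fin b → SignType) :
    IsMotzkinWalk p q (Fin.append s t) ↔ ∃ r : ℕ, IsMotzkinWalk p r s ∧ IsMotzkinWalk r q t := by
  constructor
  · rintro ⟨h1, h2⟩
    have ha := h1 a (by omega)
    rw [height_append, Nat.sub_self, height_zero] at ha
    refine ⟨((p : ℤ) + height s a).toNat, ⟨fun j hj => ?_, ?_⟩, fun j hj => ?_, ?_⟩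
    · have := h1 j (by omega)
      rw [height_append, Nat.sub_eq_zero_of_le hj, height_zero] at this
      linarith
    · rw [Int.toNat_of_nonneg (by linarith)]
    · have := h1 (a + j) (by omega)
      rw [height_append, height_of_le s (by omega), Nat.add_sub_cancel_left] at this
      rw [Int.toNat_of_nonneg (by linarith)]
      linarith
    · rw [height_append, height_of_le s (by omega), Nat.add_sub_cancel_left] at h2
      rw [Int.toNat_of_nonneg (by linarith)]
      linarith
  · rintro ⟨r, ⟨h1, h2⟩, h3, h4⟩
    refine ⟨fun j hj => ?_, ?_⟩
    · rw [height_append]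
      rcases le_total j a with h | h
      · rw [Nat.sub_eq_zero_of_le h, height_zero]
        linarith [h1 j h]
      · rw [height_of_le s h]
        linarith [h3 (j - a) (by omega)]
    · rw [height_append, height_of_le s (by omega), Nat.add_sub_cancel_left]
      linarith

theorem IsMotzkinWalk.end_unique {a p q r : ℕ} {s : Fin a → SignType}
    (h : IsMotzkinWalk p q s) (h' : IsMotzkinWalk p r s) : q = r := by
  have := h.2
  have := h'.2
  omega

theorem IsMotzkinWalk.start_unique {a p q r : ℕ} {s : Fin a → SignType}
    (h : IsMotzkinWalk p r s) (h' : IsMotzkinWalk q r s) : p = q := by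
  have := h.2
  have := h'.2
  omega

theorem IsMotzkinWalk.end_le {a p q : ℕ} {s : Fin a → SignType}
    (h : IsMotzkinWalk p q s) : q ≤ p + a := by
  have := h.2
  have := abs_le.1 (abs_height_le s a)
  omega

theorem IsMotzkinWalk.start_le {a p q : ℕ} {s : Fin a → SignType}
    (h : IsMotzkinWalk p q s) : p ≤ q + a := by
  have := h.2
  have := abs_le.1 (abs_height_le s a)
  omega

theorem motzkinCount_eq_zero_of_end {a p q : ℕ} (h : p + a < q) : motzkinCount a p q = 0 := by
  rw [motzkinCount, Finset.card_eq_zero, Finset.filter_eq_empty_iff]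
  intro s _ hs
  exact absurd hs.end_le (by omega)

theorem motzkinCount_eq_zero_of_start {a p q : ℕ} (h : q + a < p) : motzkinCount a p q = 0 := by
  rw [motzkinCount, Finset.card_eq_zero, Finset.filter_eq_empty_iff]
  intro s _ hs
  exact absurd hs.start_le (by omega)

theorem motzkinCount_eq_sum (a p q : ℕ) :
    motzkinCount a p q = ∑ s : Fin a → SignType, if IsMotzkinWalk p q s then 1 else 0 := by
  rw [motzkinCount, Finset.card_filter]

/-- The indicator function of a walk factorizes at a cut, summed over the height at the cut. -/
theorem ite_isMotzkinWalk_append {a b p q K : ℕ} (hK : p + a < K) (s : Fin a → SignType)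
    (t : Fin b → SignType) :
    (if IsMotzkinWalk p q (Fin.append s t) then 1 else 0) =
      ∑ r ∈ Finset.range K, (if IsMotzkinWalk p r s then 1 else 0) *
        (if IsMotzkinWalk r q t then 1 else 0 : ℕ) := by
  split_ifs with h
  · obtain ⟨r, h1, h2⟩ := (isMotzkinWalk_append s t).1 h
    rw [Finset.sum_eq_single r]
    · simp [h1, h2]
    · intro r' _ hr'
      rw [if_neg fun h' => hr' (h'.end_unique h1), zero_mul]
    · intro hr
      exact absurd h1.end_le (by simp at hr; omega)
  · symm
    refine Finset.sum_eq_zero fun r _ => ?_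
    by_cases h1 : IsMotzkinWalk p r s
    · rw [if_neg fun h2 => h ((isMotzkinWalk_append s t).2 ⟨r, h1, h2⟩), mul_zero]
    · rw [if_neg h1, zero_mul]

/-- Cutting a walk after `a` steps. -/
theorem motzkinCount_add (a b p q K : ℕ) (hK : p + a < K) :
    motzkinCount (a + b) p q =
      ∑ r ∈ Finset.range K, motzkinCount a p r * motzkinCount b r q := by
  simp_rw [motzkinCount_eq_sum, Finset.sum_mul_sum]
  rw [Finset.sum_comm, ← (Fin.appendEquiv a b).sum_comp, Fintype.sum_prod_type]
  refine Finset.sum_congr rfl fun s _ => ?_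
  rw [Finset.sum_comm]
  refine Finset.sum_congr rfl fun t _ => ?_
  exact ite_isMotzkinWalk_append hK s t

theorem motzkinCount_zero (p q : ℕ) : motzkinCount 0 p q = if p = q then 1 else 0 := by
  rw [motzkinCount_eq_sum, Fintype.sum_unique]
  simp [IsMotzkinWalk, height]

theorem motzkinCount_one (p q : ℕ) :
    motzkinCount 1 p q = (if p = q then 1 else 0) + (if p = q + 1 then 1 else 0) +
      (if p + 1 = q then 1 else 0) := by
  rw [motzkinCount_eq_sum, ← (Equiv.funUnique (Fin 1) SignType).symm.sum_comp]
  have key : ∀ x : SignType, IsMotzkinWalk p q ((Equiv.funUnique (Fin 1) SignType).symm x) ↔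
      (p : ℤ) + x = q := by
    intro x
    have h1 : height ((Equiv.funUnique (Fin 1) SignType).symm x) 1 = x := by
      simp [height]
    constructor
    · intro h
      rw [← h1]; exact h.2
    · intro h
      refine ⟨fun j hj => ?_, by rw [h1]; exact h⟩
      interval_cases j
      · rw [height_zero]; omega
      · rw [h1]; omega
  simp_rw [key]
  rw [show (Finset.univ : Finset SignType) = {0, -1, 1} from rfl]
  rw [Finset.sum_insert (by decide), Finset.sum_insert (by decide), Finset.sum_singleton]
  simp only [SignType.coe_zero, SignType.coe_neg_one, SignType.coe_one]
  have e1 : ((p : ℤ) + 0 = q) ↔ p = q := by omega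
  have e2 : ((p : ℤ) + -1 = q) ↔ p = q + 1 := by omega
  have e3 : ((p : ℤ) + 1 = q) ↔ p + 1 = q := by omega
  simp only [e1, e2, e3, add_assoc]

theorem motzkinCount_succ_zero (l : ℕ) :
    motzkinCount (l + 1) 0 0 = motzkinCount l 0 0 + motzkinCount l 0 1 := by
  rw [motzkinCount_add l 1 0 0 (l + 2) (by omega)]
  simp [motzkinCount_one, mul_add, Finset.sum_add_distrib]

theorem motzkinCount_succ_succ (l q : ℕ) :
    motzkinCount (l + 1) 0 (q + 1) =
      motzkinCount l 0 q + motzkinCount l 0 (q + 1) + motzkinCount l 0 (q + 2) := by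
  rw [motzkinCount_add l 1 0 (q + 1) (l + q + 4) (by omega)]
  simp only [motzkinCount_one, mul_add, Finset.sum_add_distrib, mul_ite, mul_one, mul_zero,
    Finset.sum_ite_eq', add_left_inj, Finset.mem_range, add_assoc, Nat.reduceAdd]
  rw [if_pos (by omega), if_pos (by omega), if_pos (by omega)]
  ring

/-- The number of walks does not change when the walk is read backwards; both sides satisfy the
same recursion, on the last step and on the first step respectively. -/
theorem motzkinCount_reverse (l m : ℕ) : motzkinCount l m 0 = motzkinCount l 0 m := by
  induction l generalizing m with
  | zero => simp [motzkinCount_zero, eq_comm]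
  | succ l ih =>
    have h1 : motzkinCount (1 + l) m 0 =
        ∑ r ∈ Finset.range (m + 3), motzkinCount 1 m r * motzkinCount l r 0 :=
      motzkinCount_add 1 l m 0 (m + 3) (by omega)
    rw [add_comm l 1, h1, add_comm 1 l]
    simp_rw [ih]
    cases m with
    | zero =>
      rw [motzkinCount_succ_zero]
      simp [motzkinCount_one, Finset.sum_range_succ]
    | succ m =>
      rw [motzkinCount_succ_succ]
      simp only [motzkinCount_one, add_mul, Finset.sum_add_distrib, ite_mul, one_mul, zero_mul,
        Finset.sum_ite_eq, add_left_inj, Finset.mem_range, add_assoc, Nat.reduceAdd]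
      rw [if_pos (by omega), if_pos (by omega), if_pos (by omega)]
      ring

theorem motzkinCount_zero_zero_pos (l : ℕ) : 0 < motzkinCount l 0 0 := by
  induction l with
  | zero => simp [motzkinCount_zero]
  | succ l ih => rw [motzkinCount_succ_zero]; omega

/-! ### The spectrum of the reduced density matrix -/

/-- If the power traces of a Hermitian matrix are those of the numbers `p m`, so is the trace of
`f ρ` for every `f` with `f 0 = 0`: on the finitely many eigenvalues and values of `p`, the
function `f` agrees with a polynomial without constant term. -/
theorem trace_cfc_of_trace_pow {ι : Type*} [Fintype ι] [DecidableEq ι] {ρ : Matrix ι ι ℂ}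
    (hρ : ρ.IsHermitian) (K : ℕ) (p : ℕ → ℝ)
    (h : ∀ k : ℕ, (ρ ^ (k + 1)).trace = ((∑ m ∈ Finset.range K, p m ^ (k + 1) : ℝ) : ℂ))
    (f : ℝ → ℝ) (hf : f 0 = 0) :
    (cfc f ρ).trace = ((∑ m ∈ Finset.range K, f (p m) : ℝ) : ℂ) := by
  classical
  have hfin : (spectrum ℝ ρ).Finite := Matrix.finite_real_spectrum
  set S : Finset ℝ := hfin.toFinset ∪ insert 0 ((Finset.range K).image p) with hS
  set q : Polynomial ℝ := Lagrange.interpolate S id f with hq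
  have hqS : ∀ x ∈ S, q.eval x = f x := fun x hx =>
    Lagrange.eval_interpolate_at_node (v := id) f (Function.injective_id.injOn) hx
  have h0 : q.coeff 0 = 0 := by
    rw [Polynomial.coeff_zero_eq_eval_zero, hqS 0 (by simp [hS]), hf]
  have h1 : cfc f ρ = Polynomial.aeval ρ q := by
    rw [← cfc_polynomial q ρ hρ.isSelfAdjoint]
    refine cfc_congr fun x hx => ?_
    exact (hqS x (by simp [hS, hx])).symm
  have h2 : ∀ k, (q.coeff k • ρ ^ k).trace =
      ((∑ m ∈ Finset.range K, q.coeff k * p m ^ k : ℝ) : ℂ) := by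
    intro k
    cases k with
    | zero => simp [h0]
    | succ k =>
      rw [Matrix.trace_smul, h k, ← Finset.mul_sum]
      simp
  rw [h1, Polynomial.aeval_eq_sum_range, Matrix.trace_sum, Finset.sum_congr rfl fun k _ => h2 k,
    ← Complex.ofReal_sum, Finset.sum_comm]
  congr 1
  refine Finset.sum_congr rfl fun m hm => ?_
  rw [← hqS (p m) (by simp only [hS, Finset.mem_union, Finset.mem_insert, Finset.mem_image]
                      exact Or.inr (Or.inr ⟨m, hm, rfl⟩)), Polynomial.eval_eq_sum_range]

/-- The unnormalized Schmidt vector of height `m`: the indicator function of the non-negative walks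
from height `m` to height `0`. -/
noncomputable def walkIndicator (b m : ℕ) : (Fin b → SignType) → ℂ := fun t =>
  if IsMotzkinWalk m 0 t then 1 else 0

theorem walkIndicator_dotProduct (b m m' : ℕ) :
    walkIndicator b m ⬝ᵥ walkIndicator b m' = if m = m' then (motzkinCount b m 0 : ℂ) else 0 := by
  unfold dotProduct walkIndicator
  split_ifs with h
  · subst h
    rw [motzkinCount_eq_sum]
    push_cast
    exact Finset.sum_congr rfl fun t _ => by split_ifs <;> simp
  · refine Finset.sum_eq_zero fun t _ => ?_
    by_cases h1 : IsMotzkinWalk m 0 t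
    · rw [if_neg fun h2 => h (h1.start_unique h2), mul_zero]
    · rw [if_neg h1, zero_mul]

/-- The Schmidt decomposition of the Motzkin state, as a decomposition of the reduced density
matrix. -/
theorem rhoCut_eq_sum (a b : ℕ) :
    rhoCut a b = ∑ m ∈ Finset.range (a + 1),
      ((motzkinCount a 0 m : ℂ) / motzkinCount (a + b) 0 0) •
        Matrix.vecMulVec (walkIndicator b m) (walkIndicator b m) := by
  ext t t'
  have hN : (0 : ℝ) ≤ motzkinCount (a + b) 0 0 := Nat.cast_nonneg _
  simp only [rhoCut, partialTraceFirst, pureDensity, Matrix.sum_apply, Matrix.smul_apply,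
    Matrix.vecMulVec_apply, smul_eq_mul]
  have hψ : ∀ (s : Fin a → SignType) (t : Fin b → SignType),
      motzkinState (a + b) (Fin.append s t) =
        ((1 / Real.sqrt (motzkinCount (a + b) 0 0) : ℝ) : ℂ) *
          ∑ m ∈ Finset.range (a + 1), (if IsMotzkinWalk 0 m s then 1 else 0) *
            walkIndicator b m t := by
    intro s t
    have := ite_isMotzkinWalk_append (p := 0) (q := 0) (K := a + 1) (by omega) s t
    have h2 := congrArg (Nat.cast : ℕ → ℂ) this
    push_cast at h2
    simp only [walkIndicator]
    rw [← h2, motzkinState]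
    split_ifs <;> simp
  have hterm : ∀ s : Fin a → SignType,
      motzkinState (a + b) (Fin.append s t) * star (motzkinState (a + b)) (Fin.append s t') =
        ∑ m ∈ Finset.range (a + 1), (if IsMotzkinWalk 0 m s then 1 else 0) *
          (1 / (motzkinCount (a + b) 0 0 : ℂ) * (walkIndicator b m t * walkIndicator b m t')) := by
    intro s
    have hsq : ((1 / Real.sqrt (motzkinCount (a + b) 0 0) : ℝ) : ℂ) *
        ((1 / Real.sqrt (motzkinCount (a + b) 0 0) : ℝ) : ℂ) =
          1 / (motzkinCount (a + b) 0 0 : ℂ) := by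
      rw [← Complex.ofReal_mul, div_mul_div_comm, Real.mul_self_sqrt hN]
      simp
    -- the first part `s` determines the height at the cut, so only diagonal terms survive
    by_cases hs : ∃ m, IsMotzkinWalk 0 m s
    · obtain ⟨m, hm⟩ := hs
      have hiff : ∀ r, IsMotzkinWalk 0 r s ↔ m = r :=
        fun r => ⟨fun h => hm.end_unique h, fun h => h ▸ hm⟩
      have hma : m ∈ Finset.range (a + 1) := by
        have := hm.end_le
        simp; omega
      rw [Pi.star_apply, hψ, hψ]
      simp only [hiff, ite_mul, one_mul, zero_mul, Finset.sum_ite_eq, if_pos hma]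
      rw [star_mul', ← hsq]
      have : star (walkIndicator b m t') = walkIndicator b m t' := by
        unfold walkIndicator; split_ifs <;> simp
      rw [this, show star ((1 / Real.sqrt (motzkinCount (a + b) 0 0) : ℝ) : ℂ) = _ from
        Complex.conj_ofReal _]
      ring
    · have hiff : ∀ r, IsMotzkinWalk 0 r s ↔ False := fun r => ⟨fun h => hs ⟨r, h⟩, False.elim⟩
      rw [hψ]
      simp [hiff]
  rw [Finset.sum_congr rfl fun s _ => hterm s, Finset.sum_comm]
  refine Finset.sum_congr rfl fun m _ => ?_
  rw [← Finset.sum_mul, motzkinCount_eq_sum a]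
  push_cast
  ring

/-- The Schmidt vectors are orthogonal with squared norms `M_{b,m,0}`, so each term is multiplied by
its Schmidt probability. -/
theorem rhoCut_pow (a b k : ℕ) :
    rhoCut a b ^ (k + 1) = ∑ m ∈ Finset.range (a + 1),
      ((motzkinCount a 0 m : ℂ) / motzkinCount (a + b) 0 0 * (schmidtProb a b m : ℂ) ^ k) •
        Matrix.vecMulVec (walkIndicator b m) (walkIndicator b m) := by
  induction k with
  | zero => rw [zero_add, pow_one, rhoCut_eq_sum]; simp
  | succ k ih =>
    rw [pow_succ, ih]
    conv_lhs => rw [rhoCut_eq_sum]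
    rw [Finset.sum_mul_sum]
    refine Finset.sum_congr rfl fun m hm => ?_
    rw [Finset.sum_eq_single m]
    · rw [Matrix.smul_mul, Matrix.mul_smul, Matrix.vecMulVec_mul_vecMulVec,
        walkIndicator_dotProduct, if_pos rfl, smul_smul, Matrix.vecMulVec_smul, smul_smul]
      congr 1
      rw [schmidtProb]
      push_cast
      ring
    · intro r _ hr
      rw [Matrix.smul_mul, Matrix.mul_smul, Matrix.vecMulVec_mul_vecMulVec,
        walkIndicator_dotProduct, if_neg hr.symm]
      simp
    · exact fun h => absurd hm h

theorem schmidtProb_eq_zero {a b m : ℕ} (h : min a b < m) : schmidtProb a b m = 0 := by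
  rw [schmidtProb]
  rcases min_lt_iff.1 h with h | h
  · rw [motzkinCount_eq_zero_of_end (show 0 + a < m by omega)]; simp
  · rw [motzkinCount_eq_zero_of_start (show 0 + b < m by omega)]; simp

theorem trace_rhoCut_pow (a b k : ℕ) :
    (rhoCut a b ^ (k + 1)).trace =
      ((∑ m ∈ Finset.range (min a b + 1), schmidtProb a b m ^ (k + 1) : ℝ) : ℂ) := by
  have hsub : Finset.range (min a b + 1) ⊆ Finset.range (a + 1) := by
    intro x; simp; omega
  rw [Finset.sum_subset hsub fun m _ hm => by
    rw [schmidtProb_eq_zero (by rw [Finset.mem_range] at hm; omega), zero_pow (by omega)]]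
  rw [rhoCut_pow, Matrix.trace_sum]
  push_cast
  refine Finset.sum_congr rfl fun m _ => ?_
  rw [Matrix.trace_smul, Matrix.trace_vecMulVec, walkIndicator_dotProduct, if_pos rfl, pow_succ]
  rw [smul_eq_mul, schmidtProb]
  push_cast
  ring

/-- The nonzero spectrum of the reduced density matrix consists of the Schmidt probabilities. -/
theorem trace_cfc_rhoCut (a b : ℕ) (f : ℝ → ℝ) (hf : f 0 = 0) :
    (cfc f (rhoCut a b)).trace =
      ((∑ m ∈ Finset.range (min a b + 1), f (schmidtProb a b m) : ℝ) : ℂ) :=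
  trace_cfc_of_trace_pow (rhoCut_isHermitian a b) _ _ (trace_rhoCut_pow a b) f hf

theorem trace_rhoCut_mul_cfc (a b : ℕ) (f : ℝ → ℝ) :
    (rhoCut a b * cfc f (rhoCut a b)).trace =
      ((∑ m ∈ Finset.range (min a b + 1), schmidtProb a b m * f (schmidtProb a b m) : ℝ) : ℂ) := by
  have hsa : IsSelfAdjoint (rhoCut a b) := (rhoCut_isHermitian a b).isSelfAdjoint
  have hfin : (spectrum ℝ (rhoCut a b)).Finite := Matrix.finite_real_spectrum
  rw [← trace_cfc_rhoCut a b (fun x => x * f x) (by simp)]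
  congr 1
  rw [cfc_mul (fun x : ℝ => x) f (rhoCut a b) (hfin.continuousOn _) (hfin.continuousOn _),
    cfc_id' ℝ (rhoCut a b)]

theorem sum_schmidtProb (a b : ℕ) :
    ∑ m ∈ Finset.range (min a b + 1), schmidtProb a b m = 1 := by
  have hsub : Finset.range (min a b + 1) ⊆ Finset.range (a + 1) := by
    intro x; simp; omega
  have hN : (motzkinCount (a + b) 0 0 : ℝ) ≠ 0 := by
    exact_mod_cast (motzkinCount_zero_zero_pos (a + b)).ne'
  rw [Finset.sum_subset hsub fun m _ hm => by
    rw [schmidtProb_eq_zero (by rw [Finset.mem_range] at hm; omega)]]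
  simp only [schmidtProb]
  rw [← Finset.sum_div, div_eq_one_iff_eq hN, motzkinCount_add a b 0 0 (a + 1) (by omega)]
  push_cast
  rfl

/-! ### Fourier coefficients of the step distribution -/

/-- The characteristic function of a uniform step in `{1, 0, -1}`. -/
noncomputable def stepChar (θ : ℝ) : ℝ := (1 + 2 * Real.cos θ) / 3

/-- The Fourier coefficient `∫₀^π φ(θ)^A cos (kθ) dθ` of the `A`-th power of the characteristic
function `φ` of a step; it is `π` times the probability that a free walk on `A` steps ends at
height `k`. -/
noncomputable def cosCoeff (A : ℕ) (k : ℤ) : ℝ :=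
  ∫ θ in (0 : ℝ)..Real.pi, stepChar θ ^ A * Real.cos (k * θ)

theorem continuous_stepChar : Continuous stepChar := by
  unfold stepChar; fun_prop

theorem intervalIntegrable_cosCoeff (A : ℕ) (k : ℝ) (a b : ℝ) :
    IntervalIntegrable (fun θ => stepChar θ ^ A * Real.cos (k * θ)) MeasureTheory.volume a b := by
  have := continuous_stepChar
  exact Continuous.intervalIntegrable (by fun_prop) _ _

theorem cosCoeff_neg (A : ℕ) (k : ℤ) : cosCoeff A (-k) = cosCoeff A k := by
  simp [cosCoeff]

theorem cosCoeff_zero (k : ℤ) : cosCoeff 0 k = if k = 0 then Real.pi else 0 := by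
  unfold cosCoeff
  split_ifs with h
  · simp [h]
  · have hk : (k : ℝ) ≠ 0 := by exact_mod_cast h
    simp only [pow_zero, one_mul]
    rw [intervalIntegral.integral_comp_mul_left (fun x => Real.cos x) hk, integral_cos]
    simp [Real.sin_int_mul_pi]

theorem cosCoeff_succ (A : ℕ) (k : ℤ) :
    cosCoeff (A + 1) k = (cosCoeff A (k - 1) + cosCoeff A k + cosCoeff A (k + 1)) / 3 := by
  unfold cosCoeff
  rw [← intervalIntegral.integral_add (intervalIntegrable_cosCoeff _ _ _ _)
    (intervalIntegrable_cosCoeff _ _ _ _), ← intervalIntegral.integral_add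
    ((intervalIntegrable_cosCoeff _ _ _ _).add (intervalIntegrable_cosCoeff _ _ _ _))
    (intervalIntegrable_cosCoeff _ _ _ _), ← intervalIntegral.integral_div]
  refine intervalIntegral.integral_congr fun θ _ => ?_
  push_cast
  simp only [sub_mul, add_mul, one_mul, Real.cos_sub, Real.cos_add]
  rw [pow_succ]
  conv_lhs => rw [show stepChar θ = (1 + 2 * Real.cos θ) / 3 from rfl]
  rw [show stepChar θ = (1 + 2 * Real.cos θ) / 3 from rfl]
  ring

/-- The reflection principle. -/
theorem motzkinCount_eq_cosCoeff_sub (l m : ℕ) :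
    (motzkinCount l 0 m : ℝ) = 3 ^ l / Real.pi * (cosCoeff l m - cosCoeff l (m + 2)) := by
  have hpi := Real.pi_ne_zero
  induction l generalizing m with
  | zero =>
    rw [motzkinCount_zero, cosCoeff_zero, cosCoeff_zero, if_neg (by omega : ¬ ((m : ℤ) + 2 = 0))]
    rcases Nat.eq_zero_or_pos m with h | h
    · simp [h, hpi]
    · simp [h.ne', h.ne]
  | succ l ih =>
    cases m with
    | zero =>
      rw [motzkinCount_succ_zero]
      push_cast
      rw [ih, ih, cosCoeff_succ, cosCoeff_succ, zero_sub, cosCoeff_neg]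
      norm_num
      ring
    | succ m =>
      rw [motzkinCount_succ_succ]
      push_cast
      rw [ih, ih, ih, cosCoeff_succ, cosCoeff_succ]
      push_cast
      ring_nf

/-- Integration by parts; combinatorially, the cycle lemma for walks. -/
theorem cosCoeff_sub_eq (l : ℕ) (k : ℤ) :
    cosCoeff l (k - 1) - cosCoeff l (k + 1) = 3 * k / (l + 1) * cosCoeff (l + 1) k := by
  have hc := continuous_stepChar
  have hd : ∀ θ : ℝ, HasDerivAt (fun θ => stepChar θ ^ (l + 1) * Real.sin (k * θ))
      (-((l + 1) / 3) * (stepChar θ ^ l * Real.cos (((k - 1 : ℤ) : ℝ) * θ)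
        - stepChar θ ^ l * Real.cos (((k + 1 : ℤ) : ℝ) * θ))
        + k * (stepChar θ ^ (l + 1) * Real.cos (k * θ))) θ := by
    intro θ
    have h1 : HasDerivAt stepChar (2 * (-Real.sin θ) / 3) θ :=
      (((Real.hasDerivAt_cos θ).const_mul 2).const_add 1).div_const 3
    have h2 : HasDerivAt (fun θ : ℝ => Real.sin (k * θ)) (Real.cos (k * θ) * (k * 1)) θ :=
      ((hasDerivAt_id θ).const_mul (k : ℝ)).sin
    refine ((h1.pow (l + 1)).mul h2).congr_deriv ?_
    push_cast
    simp only [Pi.pow_apply, sub_mul, add_mul, one_mul, Real.cos_sub, Real.cos_add]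
    ring
  have hFTC := intervalIntegral.integral_eq_sub_of_hasDerivAt (a := 0) (b := Real.pi)
    (fun θ _ => hd θ) (Continuous.intervalIntegrable (by fun_prop) _ _)
  rw [intervalIntegral.integral_add (Continuous.intervalIntegrable (by fun_prop) _ _)
    (Continuous.intervalIntegrable (by fun_prop) _ _), intervalIntegral.integral_const_mul,
    intervalIntegral.integral_const_mul, intervalIntegral.integral_sub
    (intervalIntegrable_cosCoeff _ _ _ _) (intervalIntegrable_cosCoeff _ _ _ _)] at hFTC
  rw [Real.sin_int_mul_pi, mul_zero, mul_zero (k : ℝ), Real.sin_zero] at hFTC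
  change -((l + 1 : ℝ) / 3) * (cosCoeff l (k - 1) - cosCoeff l (k + 1))
    + k * cosCoeff (l + 1) k = _ at hFTC
  have hl : (l + 1 : ℝ) ≠ 0 := by positivity
  field_simp
  field_simp at hFTC
  linarith

/-- The ballot-type formula: the difference of two Fourier coefficients in the reflection principle
is replaced by a single one, to which a local limit theorem without derivatives applies. -/
theorem motzkinCount_eq_cosCoeff (l m : ℕ) :
    (motzkinCount l 0 m : ℝ) =
      3 ^ l * 3 / (Real.pi * (l + 1)) * ((m + 1) * cosCoeff (l + 1) (m + 1)) := by
  have h := cosCoeff_sub_eq l (m + 1)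
  rw [add_sub_cancel_right, add_assoc, one_add_one_eq_two] at h
  rw [motzkinCount_eq_cosCoeff_sub, h]
  push_cast
  have hpi := Real.pi_ne_zero
  have hl : (l + 1 : ℝ) ≠ 0 := by positivity
  field_simp

theorem cosCoeff_nonneg (l m : ℕ) : 0 ≤ cosCoeff (l + 1) (m + 1) := by
  have h := motzkinCount_eq_cosCoeff l m
  have h0 : (0 : ℝ) ≤ motzkinCount l 0 m := Nat.cast_nonneg _
  rw [h] at h0
  have hpi := Real.pi_pos
  exact nonneg_of_mul_nonneg_right (nonneg_of_mul_nonneg_right h0 (by positivity)) (by positivity)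

/-- The difference is a number of non-negative walks, up to a positive factor. -/
theorem cosCoeff_add_two_le (l : ℕ) {k : ℤ} (hk : 0 ≤ k) : cosCoeff l (k + 2) ≤ cosCoeff l k := by
  obtain ⟨m, rfl⟩ := Int.eq_ofNat_of_zero_le hk
  have h := motzkinCount_eq_cosCoeff_sub l m
  have h0 : (0 : ℝ) ≤ motzkinCount l 0 m := Nat.cast_nonneg _
  rw [h] at h0
  have hpi := Real.pi_pos
  have := nonneg_of_mul_nonneg_right h0 (by positivity)
  linarith

theorem cosCoeff_le_sub_two_mul (l : ℕ) (k : ℤ) (i : ℕ) (hi : 0 ≤ k - 2 * i) :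
    cosCoeff l k ≤ cosCoeff l (k - 2 * i) := by
  induction i with
  | zero => simp
  | succ i ih =>
    push_cast at hi ⊢
    refine (ih (by linarith)).trans ?_
    have := cosCoeff_add_two_le l hi
    rwa [show k - 2 * ((i : ℤ) + 1) + 2 = k - 2 * i by ring] at this

/-- The probability that a free walk on `A` steps ends at one of the heights
`k, k + 2, k + 4, …`. -/
noncomputable def walkTail : ℕ → ℤ → ℝ
  | 0, k => if k ≤ 0 ∧ Even k then 1 else 0
  | A + 1, k => (walkTail A (k - 1) + walkTail A k + walkTail A (k + 1)) / 3

theorem walkTail_nonneg (A : ℕ) (k : ℤ) : 0 ≤ walkTail A k := by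
  induction A generalizing k with
  | zero => rw [walkTail]; split_ifs <;> norm_num
  | succ A ih => rw [walkTail]; linarith [ih (k - 1), ih k, ih (k + 1)]

theorem cosCoeff_eq_walkTail (A : ℕ) (k : ℤ) :
    cosCoeff A k = Real.pi * (walkTail A k - walkTail A (k + 2)) := by
  induction A generalizing k with
  | zero =>
    rw [cosCoeff_zero, walkTail, walkTail]
    have h1 : Even (k + 2) ↔ Even k := by simp
    simp only [h1]
    by_cases hk : Even k
    · obtain ⟨j, rfl⟩ := hk
      simp only [Even.add_self, and_true]
      split_ifs <;> first | omega | simp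
    · have : k ≠ 0 := by rintro rfl; simp at hk
      simp [hk, this]
  | succ A ih =>
    rw [cosCoeff_succ, walkTail, walkTail, ih, ih, ih,
      show k - 1 + 2 = k + 2 - 1 by ring, show k + 1 + 2 = k + 2 + 1 by ring]
    ring

/-- Chernoff's bound. -/
theorem walkTail_le (A : ℕ) (k : ℤ) {τ : ℝ} (hτ : 0 ≤ τ) :
    walkTail A k ≤ Real.exp (A * τ ^ 2 / 2 - τ * k) := by
  induction A generalizing k with
  | zero =>
    rw [walkTail]
    split_ifs with h
    · have h1 : (k : ℝ) ≤ 0 := by exact_mod_cast h.1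
      rw [← Real.exp_zero]
      apply Real.exp_le_exp.2
      push_cast
      nlinarith
    · positivity
  | succ A ih =>
    rw [walkTail]
    have h1 := Real.cosh_le_exp_half_sq τ
    have h2 : (1 : ℝ) ≤ Real.exp (τ ^ 2 / 2) := Real.one_le_exp (by positivity)
    rw [Real.cosh_eq] at h1
    have e1 := ih (k - 1)
    have e2 := ih k
    have e3 := ih (k + 1)
    have f1 : Real.exp (A * τ ^ 2 / 2 - τ * ((k - 1 : ℤ) : ℝ)) =
        Real.exp (A * τ ^ 2 / 2 - τ * k) * Real.exp τ := by
      rw [← Real.exp_add]; push_cast; ring_nf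
    have f3 : Real.exp (A * τ ^ 2 / 2 - τ * ((k + 1 : ℤ) : ℝ)) =
        Real.exp (A * τ ^ 2 / 2 - τ * k) * Real.exp (-τ) := by
      rw [← Real.exp_add]; push_cast; ring_nf
    have f : Real.exp ((A + 1 : ℕ) * τ ^ 2 / 2 - τ * k) =
        Real.exp (A * τ ^ 2 / 2 - τ * k) * Real.exp (τ ^ 2 / 2) := by
      rw [← Real.exp_add]; push_cast; ring_nf
    rw [f1] at e1
    rw [f3] at e3
    rw [f]
    have hE := Real.exp_pos (A * τ ^ 2 / 2 - τ * k)
    nlinarith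

/-- Away from the origin, monotonicity turns the tail bound into a bound for a single Fourier
coefficient: `cosCoeff A k` is at most the average of the coefficients at `k, k - 2, …`, about `k/4`
of them, all beyond `k/2`. -/
theorem mul_cosCoeff_le {A : ℕ} (hA : 0 < A) (k : ℕ) :
    (k : ℝ) / 4 * cosCoeff A k ≤ Real.pi * Real.exp (-(k ^ 2 / (8 * A))) := by
  have hpi := Real.pi_pos
  have hA' : (0 : ℝ) < A := by exact_mod_cast hA
  rcases Nat.eq_zero_or_pos k with rfl | hk
  · simp; positivity
  set n : ℕ := (k + 3) / 4 with hn
  -- the sum telescopes to a tail of the free walk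
  have h1 : (n : ℝ) * cosCoeff A k ≤ ∑ i ∈ Finset.range n, cosCoeff A (k - 2 * i) := by
    have := Finset.card_nsmul_le_sum (Finset.range n) (fun i : ℕ => cosCoeff A (k - 2 * i))
      (cosCoeff A k) (fun i hi => cosCoeff_le_sub_two_mul A k i
        (by rw [Finset.mem_range] at hi; omega))
    simpa using this
  have h2 : ∑ i ∈ Finset.range n, cosCoeff A (k - 2 * i) =
      Real.pi * (walkTail A (k - 2 * n + 2) - walkTail A (k + 2)) := by
    have : ∀ i : ℕ, cosCoeff A (k - 2 * i) =
        Real.pi * walkTail A (k - 2 * ((i + 1 : ℕ) : ℤ) + 2) -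
          Real.pi * walkTail A (k - 2 * (i : ℤ) + 2) := by
      intro i
      rw [cosCoeff_eq_walkTail, mul_sub]
      push_cast
      ring_nf
    rw [Finset.sum_congr rfl fun i _ => this i,
      Finset.sum_range_sub (fun i : ℕ => Real.pi * walkTail A (k - 2 * (i : ℤ) + 2))]
    simp
    ring
  -- `τ = k / (2 A)` minimizes the exponent `A τ² / 2 - τ k / 2`
  have h3 := walkTail_le A ((k : ℤ) - 2 * n + 2) (τ := k / (2 * A)) (by positivity)
  have h4 := walkTail_nonneg A (k + 2)
  have h5 : (k : ℝ) / 2 ≤ (((k : ℤ) - 2 * n + 2 : ℤ) : ℝ) := by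
    have : (k : ℤ) ≤ 2 * ((k : ℤ) - 2 * n + 2) := by omega
    have : (k : ℝ) ≤ 2 * (((k : ℤ) - 2 * n + 2 : ℤ) : ℝ) := by exact_mod_cast this
    linarith
  have h6 : Real.exp (A * ((k : ℝ) / (2 * A)) ^ 2 / 2 -
      (k : ℝ) / (2 * A) * (((k : ℤ) - 2 * n + 2 : ℤ) : ℝ)) ≤ Real.exp (-(k ^ 2 / (8 * A))) := by
    apply Real.exp_le_exp.2
    have h7 : (k : ℝ) / (2 * A) * ((k : ℝ) / 2) ≤
        (k : ℝ) / (2 * A) * (((k : ℤ) - 2 * n + 2 : ℤ) : ℝ) :=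
      mul_le_mul_of_nonneg_left h5 (by positivity)
    have h8 : A * ((k : ℝ) / (2 * A)) ^ 2 / 2 - (k : ℝ) / (2 * A) * ((k : ℝ) / 2) =
        -(k ^ 2 / (8 * A)) := by
      field_simp; ring
    linarith
  have h9 : (k : ℝ) / 4 ≤ n := by
    have : k ≤ 4 * n := by omega
    have : (k : ℝ) ≤ 4 * n := by exact_mod_cast this
    linarith
  have h10 : 0 ≤ cosCoeff A k := by
    obtain ⟨l, rfl⟩ : ∃ l, A = l + 1 := ⟨A - 1, by omega⟩
    obtain ⟨m, rfl⟩ : ∃ m, k = m + 1 := ⟨k - 1, by omega⟩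
    exact_mod_cast cosCoeff_nonneg l m
  calc (k : ℝ) / 4 * cosCoeff A k ≤ n * cosCoeff A k := mul_le_mul_of_nonneg_right h9 h10
    _ ≤ Real.pi * (walkTail A (k - 2 * n + 2) - walkTail A (k + 2)) := h1.trans h2.le
    _ ≤ _ := mul_le_mul_of_nonneg_left (by linarith) hpi.le

/-! ### The local limit theorem -/

open MeasureTheory Filter Topology in
theorem integral_gaussian_mul_cos_Ioi {b : ℝ} (hb : 0 < b) (t : ℝ) :
    ∫ x in Set.Ioi (0 : ℝ), Real.exp (-b * x ^ 2) * Real.cos (t * x) =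
      √(Real.pi / b) / 2 * Real.exp (-(t ^ 2 / (4 * b))) := by
  have h1 := integral_comp_abs (f := fun x => Real.exp (-b * x ^ 2) * Real.cos (t * x))
  have h2 : ∀ x : ℝ, Real.exp (-b * |x| ^ 2) * Real.cos (t * |x|) =
      Real.exp (-b * x ^ 2) * Real.cos (t * x) := by
    intro x
    rcases abs_choice x with h | h <;> simp [h]
  simp only [h2] at h1
  have h3 := fourierIntegral_gaussian (b := (b : ℂ)) (by simpa using hb) t
  have hint : Integrable (fun x : ℝ =>
      Complex.exp (Complex.I * t * x) * Complex.exp (-(b : ℂ) * x ^ 2)) := by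
    have := integrable_cexp_quadratic (b := (b : ℂ)) (by simpa using hb) (Complex.I * t) 0
    refine this.congr (Eventually.of_forall fun x => ?_)
    simp only [← Complex.exp_add]
    congr 1; ring
  have h4 : ∀ x : ℝ, (Complex.exp (Complex.I * t * x) * Complex.exp (-(b : ℂ) * x ^ 2)).re =
      Real.exp (-b * x ^ 2) * Real.cos (t * x) := by
    intro x
    rw [show Complex.exp (-(b : ℂ) * x ^ 2) = ((Real.exp (-b * x ^ 2) : ℝ) : ℂ) by push_cast; rfl,
      Complex.re_mul_ofReal, show Complex.I * t * x = ((t * x : ℝ) : ℂ) * Complex.I by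
        push_cast; ring, Complex.exp_ofReal_mul_I_re, mul_comm]
  have h5 := congrArg Complex.re h3
  have h6 : (∫ x : ℝ, Complex.exp (Complex.I * t * x) * Complex.exp (-(b : ℂ) * x ^ 2)).re =
      ∫ x : ℝ, (Complex.exp (Complex.I * t * x) * Complex.exp (-(b : ℂ) * x ^ 2)).re :=
    (integral_re hint).symm
  rw [h6] at h5
  simp only [h4] at h5
  have h7 : ((Real.pi : ℂ) / b) ^ (1 / 2 : ℂ) * Complex.exp (-(t : ℂ) ^ 2 / (4 * b)) =
      ((√(Real.pi / b) * Real.exp (-(t ^ 2 / (4 * b))) : ℝ) : ℂ) := by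
    rw [Real.sqrt_eq_rpow]
    push_cast [Complex.ofReal_cpow (div_pos Real.pi_pos hb).le]
    congr 2
    ring
  rw [h7, Complex.ofReal_re] at h5
  linarith

/-- The constant `1/π²` keeps the bound valid also near `θ = π`, where `φ` is negative:
`|φ| ≤ 1/3 ≤ exp (-1)` there. -/
theorem abs_stepChar_le {θ : ℝ} (h : |θ| ≤ Real.pi) :
    |stepChar θ| ≤ Real.exp (-(1 / Real.pi ^ 2) * θ ^ 2) := by
  have hpi := Real.pi_pos
  have h1 := Real.cos_le_one_sub_mul_cos_sq h
  have h2 : θ ^ 2 ≤ Real.pi ^ 2 := sq_le_sq.2 (by rwa [abs_of_pos hpi])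
  have h3 : 0 ≤ 1 / Real.pi ^ 2 * θ ^ 2 := by positivity
  have h4 : 1 / Real.pi ^ 2 * θ ^ 2 ≤ 1 := by
    rw [one_div, inv_mul_le_iff₀ (by positivity)]; linarith
  have h5 : 2 / Real.pi ^ 2 * θ ^ 2 = 2 * (1 / Real.pi ^ 2 * θ ^ 2) := by ring
  rw [h5] at h1
  rw [neg_mul]
  set y := 1 / Real.pi ^ 2 * θ ^ 2
  rw [abs_le]
  constructor
  · have h6 : Real.exp (-1) ≤ Real.exp (-y) := Real.exp_le_exp.2 (by linarith)
    have h7 : (1 / 3 : ℝ) ≤ Real.exp (-1) := by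
      rw [Real.exp_neg, one_div]
      exact inv_anti₀ (Real.exp_pos 1) (by linarith [Real.exp_one_lt_d9])
    have := Real.neg_one_le_cos θ
    unfold stepChar
    linarith
  · have := Real.add_one_le_exp (-y)
    unfold stepChar
    linarith

/-- The rescaled power `φ(x/√A)^A` of the characteristic function of a step, cut off at the image
of `π` under the rescaling. -/
noncomputable def scaledChar (A : ℕ) : ℝ → ℝ :=
  (Set.Ioc 0 (√A * Real.pi)).indicator fun x => stepChar (x / √A) ^ A

theorem measurable_scaledChar (A : ℕ) : Measurable (scaledChar A) := by
  have := continuous_stepChar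
  exact (Continuous.measurable (by fun_prop)).indicator measurableSet_Ioc

theorem abs_scaledChar_le (A : ℕ) (x : ℝ) :
    |scaledChar A x| ≤ Real.exp (-(1 / Real.pi ^ 2) * x ^ 2) := by
  unfold scaledChar
  by_cases hx : x ∈ Set.Ioc 0 (√A * Real.pi)
  · rw [Set.indicator_of_mem hx]
    have hA : 0 < √(A : ℝ) := by
      rcases (Real.sqrt_nonneg (A : ℝ)).eq_or_lt with h | h
      · rw [← h, zero_mul] at hx
        exact absurd (hx.1.trans_le hx.2) (lt_irrefl _)
      · exact h
    have h1 : |x / √A| ≤ Real.pi := by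
      rw [abs_of_pos (div_pos hx.1 hA), div_le_iff₀ hA, mul_comm]
      exact hx.2
    rw [abs_pow]
    refine (pow_le_pow_left₀ (abs_nonneg _) (abs_stepChar_le h1) A).trans_eq ?_
    rw [← Real.exp_nat_mul, div_pow, Real.sq_sqrt (Nat.cast_nonneg A)]
    congr 1
    have : (A : ℝ) ≠ 0 := (Real.sqrt_pos.1 hA).ne'
    field_simp
  · rw [Set.indicator_of_notMem hx, abs_zero]
    positivity

theorem sqrt_mul_cosCoeff (A : ℕ) (k : ℤ) :
    √A * cosCoeff A k =
      ∫ x in Set.Ioi (0 : ℝ), scaledChar A x * Real.cos (k / √A * x) := by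
  have hpi := Real.pi_pos
  rcases Nat.eq_zero_or_pos A with rfl | hA
  · simp [scaledChar]
  have hs : 0 < √(A : ℝ) := Real.sqrt_pos.2 (by exact_mod_cast hA)
  have h1 := intervalIntegral.integral_comp_div (a := 0) (b := √A * Real.pi)
    (fun θ => stepChar θ ^ A * Real.cos (k * θ)) hs.ne'
  rw [zero_div, mul_div_cancel_left₀ _ hs.ne', smul_eq_mul] at h1
  rw [cosCoeff, ← h1, intervalIntegral.integral_of_le (by positivity)]
  have h2 : ∀ x : ℝ, scaledChar A x * Real.cos (k / √A * x) =
      (Set.Ioc 0 (√A * Real.pi)).indicator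
        (fun x => stepChar (x / √A) ^ A * Real.cos (k * (x / √A))) x := by
    intro x
    unfold scaledChar
    by_cases hx : x ∈ Set.Ioc 0 (√A * Real.pi)
    · rw [Set.indicator_of_mem hx, Set.indicator_of_mem hx]
      congr 2; ring
    · rw [Set.indicator_of_notMem hx, Set.indicator_of_notMem hx, zero_mul]
  simp only [h2]
  rw [MeasureTheory.setIntegral_indicator measurableSet_Ioc,
    Set.inter_eq_self_of_subset_right fun x hx => hx.1]

section
open MeasureTheory Filter Topology

theorem integrableOn_gaussian {b : ℝ} (hb : 0 < b) :
    IntegrableOn (fun x : ℝ => Real.exp (-b * x ^ 2)) (Set.Ioi 0) :=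
  (integrable_exp_neg_mul_sq hb).integrableOn

theorem integrableOn_scaledChar (A : ℕ) : IntegrableOn (scaledChar A) (Set.Ioi 0) := by
  have hpi := Real.pi_pos
  exact Integrable.mono' (integrableOn_gaussian (b := 1 / Real.pi ^ 2) (by positivity))
    (measurable_scaledChar A).aestronglyMeasurable
    (Eventually.of_forall fun x => abs_scaledChar_le A x)

/-- The limit rests on `A (φ(x/√A) - 1) = -(x²/3) sinc² (x/(2√A))`. -/
theorem tendsto_scaledChar {x : ℝ} (hx : 0 < x) :
    Tendsto (fun A => scaledChar A x) atTop (𝓝 (Real.exp (-(1 / 3) * x ^ 2))) := by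
  have hpi := Real.pi_pos
  have hs : Tendsto (fun A : ℕ => √(A : ℝ)) atTop atTop :=
    Real.tendsto_sqrt_atTop.comp tendsto_natCast_atTop_atTop
  have hlim : Tendsto (fun A : ℕ => -(1 / 3) * x ^ 2 * Real.sinc (x / √A / 2) ^ 2) atTop
      (𝓝 (-(1 / 3) * x ^ 2 * Real.sinc 0 ^ 2)) := by
    have h0 : Tendsto (fun A : ℕ => x / √(A : ℝ) / 2) atTop (𝓝 0) := by
      simpa using (hs.const_div_atTop x).div_const 2
    exact (((Real.continuous_sinc.tendsto 0).comp h0).pow 2).const_mul _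
  rw [Real.sinc_zero, one_pow, mul_one] at hlim
  have hmul : Tendsto (fun A : ℕ => (A : ℝ) * (stepChar (x / √A) - 1)) atTop
      (𝓝 (-(1 / 3) * x ^ 2)) := by
    refine hlim.congr' ?_
    filter_upwards [eventually_gt_atTop 0] with A hA
    have hA' : (0 : ℝ) < A := by exact_mod_cast hA
    have hsA : 0 < √(A : ℝ) := Real.sqrt_pos.2 hA'
    have hy : x / √(A : ℝ) / 2 ≠ 0 := by positivity
    have hcos : Real.cos (x / √A) = 1 - 2 * Real.sin (x / √A / 2) ^ 2 := by
      conv_lhs => rw [show x / √(A : ℝ) = 2 * (x / √A / 2) by ring, Real.cos_two_mul]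
      rw [Real.cos_sq']; ring
    rw [Real.sinc_of_ne_zero hy, stepChar, hcos]
    have : √(A : ℝ) ^ 2 = A := Real.sq_sqrt hA'.le
    generalize Real.sin (x / √A / 2) = S
    field_simp
    rw [this]
    ring
  have := Real.tendsto_one_add_pow_exp_of_tendsto hmul
  refine this.congr' ?_
  filter_upwards [hs.eventually_ge_atTop (x / Real.pi)] with A hA
  rw [scaledChar, Set.indicator_of_mem]
  · ring
  · exact ⟨hx, by rwa [div_le_iff₀ hpi] at hA⟩

theorem tendsto_integral_abs_scaledChar_sub :
    Tendsto (fun A => ∫ x in Set.Ioi (0 : ℝ), |scaledChar A x - Real.exp (-(1 / 3) * x ^ 2)|)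
      atTop (𝓝 0) := by
  have hpi := Real.pi_pos
  have hpi3 := Real.pi_gt_three
  have hb : 0 < 1 / Real.pi ^ 2 := by positivity
  have key := tendsto_integral_of_dominated_convergence (μ := volume.restrict (Set.Ioi (0 : ℝ)))
    (F := fun A x => |scaledChar A x - Real.exp (-(1 / 3) * x ^ 2)|) (f := fun _ => (0 : ℝ))
    (fun x => 2 * Real.exp (-(1 / Real.pi ^ 2) * x ^ 2))
    (fun A => ((measurable_scaledChar A).sub (by fun_prop)).abs.aestronglyMeasurable)
    ((integrableOn_gaussian hb).const_mul 2) ?_ ?_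
  · simpa using key
  · intro A
    refine Eventually.of_forall fun x => ?_
    rw [Real.norm_eq_abs, abs_abs]
    refine (abs_sub _ _).trans ?_
    have h1 := abs_scaledChar_le A x
    have h2 : Real.exp (-(1 / 3) * x ^ 2) ≤ Real.exp (-(1 / Real.pi ^ 2) * x ^ 2) := by
      apply Real.exp_le_exp.2
      have : 1 / Real.pi ^ 2 ≤ 1 / 3 := one_div_le_one_div_of_le (by norm_num) (by nlinarith)
      nlinarith [sq_nonneg x]
    rw [abs_of_pos (Real.exp_pos _)]
    linarith
  · filter_upwards [ae_restrict_mem measurableSet_Ioi] with x hx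
    have := ((tendsto_scaledChar hx).sub_const (Real.exp (-(1 / 3) * x ^ 2))).abs
    simpa using this

/-- The local limit theorem, uniformly in the end point of the walk. -/
theorem cosCoeff_local_limit {ε : ℝ} (hε : 0 < ε) : ∀ᶠ A : ℕ in atTop, ∀ k : ℤ,
    |√A * cosCoeff A k - √(3 * Real.pi) / 2 * Real.exp (-(3 * k ^ 2 / (4 * A)))| < ε := by
  filter_upwards [tendsto_integral_abs_scaledChar_sub.eventually (gt_mem_nhds hε)] with A hA k
  refine lt_of_le_of_lt ?_ hA
  have h1 := integral_gaussian_mul_cos_Ioi (b := 1 / 3) (by norm_num) (k / √A)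
  have h2 : √(Real.pi / (1 / 3)) / 2 * Real.exp (-((k / √A) ^ 2 / (4 * (1 / 3)))) =
      √(3 * Real.pi) / 2 * Real.exp (-(3 * k ^ 2 / (4 * A))) := by
    rw [div_pow, Real.sq_sqrt (Nat.cast_nonneg A)]
    congr 3
    · ring
    · ring
  have hcos : ∀ f : ℝ → ℝ, Measurable f → IntegrableOn f (Set.Ioi 0) →
      IntegrableOn (fun x => f x * Real.cos (k / √A * x)) (Set.Ioi 0) := by
    intro f hm hf
    refine Integrable.mono' hf.norm (hm.mul (by fun_prop)).aestronglyMeasurable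
      (Eventually.of_forall fun x => ?_)
    rw [norm_mul]
    exact mul_le_of_le_one_right (norm_nonneg _) (Real.abs_cos_le_one _)
  rw [← h2, ← h1, sqrt_mul_cosCoeff, ← integral_sub
    (hcos _ (measurable_scaledChar A) (integrableOn_scaledChar A))
    (hcos _ (by fun_prop) (integrableOn_gaussian (by norm_num)))]
  refine (abs_integral_le_integral_abs).trans ?_
  refine integral_mono_of_nonneg (Eventually.of_forall fun x => abs_nonneg _)
    ((integrableOn_scaledChar A).sub (integrableOn_gaussian (by norm_num))).abs
    (Eventually.of_forall fun x => ?_)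
  simp only
  rw [← sub_mul, abs_mul]
  exact mul_le_of_le_one_right (abs_nonneg _) (Real.abs_cos_le_one _)

theorem abs_sqrt_mul_cosCoeff_le (A : ℕ) (k : ℤ) :
    |√A * cosCoeff A k| ≤ √(Real.pi / (1 / Real.pi ^ 2)) / 2 := by
  have hpi := Real.pi_pos
  rw [sqrt_mul_cosCoeff, ← integral_gaussian_Ioi]
  refine (abs_integral_le_integral_abs).trans ?_
  refine integral_mono_of_nonneg (Eventually.of_forall fun x => abs_nonneg _)
    (integrableOn_gaussian (by positivity)) (Eventually.of_forall fun x => ?_)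
  simp only
  rw [abs_mul]
  exact (mul_le_of_le_one_right (abs_nonneg _) (Real.abs_cos_le_one _)).trans
    (abs_scaledChar_le A x)

/-- A Gaussian bound for the Fourier coefficients, uniform in the length of the walk: near the
origin it is the trivial bound, beyond `√A` it is the averaged tail bound. -/
theorem exists_sqrt_mul_cosCoeff_le : ∃ C : ℝ, 0 < C ∧ ∀ A : ℕ, 0 < A → ∀ k : ℕ,
    √A * cosCoeff A k ≤ C * Real.exp (-(k ^ 2 / (8 * A))) := by
  have hpi := Real.pi_pos
  set C₁ : ℝ := √(Real.pi / (1 / Real.pi ^ 2)) / 2 with hC₁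
  have hC₁0 : 0 ≤ C₁ := by positivity
  refine ⟨C₁ * Real.exp (1 / 8) + 4 * Real.pi, by positivity, fun A hA k => ?_⟩
  have hA' : (0 : ℝ) < A := by exact_mod_cast hA
  have hs : 0 < √(A : ℝ) := Real.sqrt_pos.2 hA'
  have hss : √(A : ℝ) ^ 2 = A := Real.sq_sqrt hA'.le
  rw [add_mul]
  rcases le_total (k : ℝ) (√A) with h | h
  · have h1 := (le_abs_self _).trans (abs_sqrt_mul_cosCoeff_le A k)
    have h2 : (1 : ℝ) ≤ Real.exp (1 / 8) * Real.exp (-(k ^ 2 / (8 * A))) := by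
      rw [← Real.exp_add]
      apply Real.one_le_exp
      have : (k : ℝ) ^ 2 ≤ A := by rw [← hss]; gcongr
      have : (k : ℝ) ^ 2 / (8 * A) ≤ 1 / 8 := by
        rw [div_le_div_iff₀ (by positivity) (by norm_num)]; linarith
      linarith
    have h3 : 0 ≤ 4 * Real.pi * Real.exp (-((k : ℝ) ^ 2 / (8 * A))) := by positivity
    have h4 := mul_le_mul_of_nonneg_left h2 hC₁0
    rw [mul_one, ← mul_assoc] at h4
    linarith
  · have h1 := mul_cosCoeff_le hA k
    have hk : (0 : ℝ) < k := hs.trans_le h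
    have hE : 0 < Real.exp (-((k : ℝ) ^ 2 / (8 * A))) := Real.exp_pos _
    have h2 : cosCoeff A k ≤ 4 * Real.pi * Real.exp (-((k : ℝ) ^ 2 / (8 * A))) / k := by
      rw [le_div_iff₀ hk]; linarith
    have h3 : √(A : ℝ) * cosCoeff A k ≤ 4 * Real.pi * Real.exp (-((k : ℝ) ^ 2 / (8 * A))) := by
      refine (mul_le_mul_of_nonneg_left h2 hs.le).trans ?_
      rw [mul_div_assoc', div_le_iff₀ hk]
      nlinarith [mul_pos hpi hE]
    have : 0 ≤ C₁ * Real.exp (1 / 8) * Real.exp (-((k : ℝ) ^ 2 / (8 * A))) := by positivity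
    linarith

end

/-! ### The scaling limit of the Schmidt probabilities -/

section
open MeasureTheory Filter Topology

/-- The length scale `s` of the height of the walk at the cut: `s² = σ² A B / (A + B)`, where
`σ² = 2/3` is the variance of a step, `A = a + 1` and `B = b + 1`. -/
noncomputable def cutScale (a b : ℕ) : ℝ :=
  √(2 / 3 * ((a + 1) * (b + 1)) / (a + b + 2))

theorem cutScale_sq (a b : ℕ) :
    cutScale a b ^ 2 = 2 / 3 * ((a + 1) * (b + 1)) / (a + b + 2) :=
  Real.sq_sqrt (by positivity)

theorem cutScale_pos (a b : ℕ) : 0 < cutScale a b := Real.sqrt_pos.2 (by positivity)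

theorem min_le_cutScale_sq (a b : ℕ) : ((min a b : ℕ) + 1 : ℝ) / 3 ≤ cutScale a b ^ 2 := by
  rw [cutScale_sq, div_le_div_iff₀ (by norm_num) (by positivity)]
  rcases le_total a b with h | h
  · rw [min_eq_left h]
    have : (a : ℝ) ≤ b := by exact_mod_cast h
    have h0 : (0 : ℝ) ≤ a := Nat.cast_nonneg a
    nlinarith
  · rw [min_eq_right h]
    have : (b : ℝ) ≤ a := by exact_mod_cast h
    have h0 : (0 : ℝ) ≤ b := Nat.cast_nonneg b
    nlinarith

theorem inv_cutScale_le (a b : ℕ) : 1 / cutScale a b ≤ 2 := by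
  have h1 := min_le_cutScale_sq a b
  have h2 : (0 : ℝ) ≤ (min a b : ℕ) := Nat.cast_nonneg _
  have h3 := cutScale_pos a b
  rw [div_le_iff₀ h3]
  by_contra! h
  nlinarith

theorem tendsto_cutScale :
    Tendsto (fun p : ℕ × ℕ => cutScale p.1 p.2) atTop atTop := by
  rw [← prod_atTop_atTop_eq]
  have hmin : Tendsto (fun p : ℕ × ℕ => (((min p.1 p.2 : ℕ) : ℝ) + 1) / 3)
      (atTop ×ˢ atTop) atTop := by
    have h1 : Tendsto (fun p : ℕ × ℕ => min p.1 p.2) (atTop ×ˢ atTop) atTop := by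
      refine tendsto_atTop.2 fun K => ?_
      filter_upwards [tendsto_fst.eventually_ge_atTop K, tendsto_snd.eventually_ge_atTop K]
        with p h1 h2 using le_min h1 h2
    exact (tendsto_atTop_add_const_right _ _
      (tendsto_natCast_atTop_atTop.comp h1)).atTop_div_const (by norm_num)
  have h2 : Tendsto (fun p : ℕ × ℕ => √((((min p.1 p.2 : ℕ) : ℝ) + 1) / 3))
      (atTop ×ˢ atTop) atTop := Real.tendsto_sqrt_atTop.comp hmin
  refine tendsto_atTop_mono (fun p => ?_) h2
  rw [Real.sqrt_le_left (cutScale_pos _ _).le]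
  exact min_le_cutScale_sq p.1 p.2

/-- The rescaled product of the two Fourier coefficients that make up the Schmidt probability of
height `k - 1`. -/
noncomputable def coeffProd (a b k : ℕ) : ℝ :=
  (√(a + 1 : ℕ) * cosCoeff (a + 1) k) * (√(b + 1 : ℕ) * cosCoeff (b + 1) k)

/-- The factor `c` depends on `a` and `b` only; its value plays no role, as the Schmidt probabilities
sum to `1`. -/
theorem exists_schmidtProb_eq (a b : ℕ) : ∃ c : ℝ, 0 < c ∧ ∀ m,
    schmidtProb a b m = c * (((m + 1 : ℕ) : ℝ) ^ 2 * coeffProd a b (m + 1)) := by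
  have hpi := Real.pi_pos
  have hN : (0 : ℝ) < motzkinCount (a + b) 0 0 := by
    exact_mod_cast motzkinCount_zero_zero_pos (a + b)
  refine ⟨3 ^ a * 3 / (Real.pi * (a + 1)) * (3 ^ b * 3 / (Real.pi * (b + 1))) /
    (motzkinCount (a + b) 0 0) / (√(a + 1 : ℕ) * √(b + 1 : ℕ)), by positivity, fun m => ?_⟩
  rw [schmidtProb, motzkinCount_reverse, motzkinCount_eq_cosCoeff, motzkinCount_eq_cosCoeff,
    coeffProd]
  have h1 : √((a + 1 : ℕ) : ℝ) ≠ 0 := by positivity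
  have h2 : √((b + 1 : ℕ) : ℝ) ≠ 0 := by positivity
  generalize √((a + 1 : ℕ) : ℝ) = x at *
  generalize √((b + 1 : ℕ) : ℝ) = y at *
  push_cast
  field_simp

/-- The unnormalized profile of the Schmidt probabilities on the scale `cutScale a b`: the point `x`
stands for `k = ⌈x s⌉`, that is, for height `k - 1`. -/
noncomputable def profile (a b : ℕ) (x : ℝ) : ℝ :=
  ((⌈x * cutScale a b⌉₊ : ℝ) / cutScale a b) ^ 2 * coeffProd a b ⌈x * cutScale a b⌉₊

/-- The Gaussian exponents of the two parts of the chain add up to one on the scale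
`cutScale a b`. -/
theorem cutScale_exponent (a b : ℕ) (k c : ℝ) :
    k ^ 2 * c / (a + 1 : ℕ) + k ^ 2 * c / (b + 1 : ℕ) =
      2 / 3 * c * (k / cutScale a b) ^ 2 := by
  rw [div_pow, cutScale_sq]
  push_cast
  field_simp
  ring

theorem tendsto_profile {x : ℝ} (hx : 0 < x) :
    Tendsto (fun p : ℕ × ℕ => profile p.1 p.2 x) atTop
      (𝓝 (3 * Real.pi / 4 * (x ^ 2 * Real.exp (-(1 / 2) * x ^ 2)))) := by
  have hpi := Real.pi_pos
  have hk : Tendsto (fun p : ℕ × ℕ => (⌈x * cutScale p.1 p.2⌉₊ : ℝ) / cutScale p.1 p.2) atTop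
      (𝓝 x) := (tendsto_nat_ceil_mul_div_atTop hx.le).comp tendsto_cutScale
  -- the error of the local limit theorem at the moving height
  have hδ : ∀ (π' : ℕ × ℕ → ℕ), Tendsto π' atTop atTop → Tendsto (fun p : ℕ × ℕ =>
      √(π' p + 1 : ℕ) * cosCoeff (π' p + 1) ⌈x * cutScale p.1 p.2⌉₊ - √(3 * Real.pi) / 2 *
        Real.exp (-(3 * (⌈x * cutScale p.1 p.2⌉₊ : ℝ) ^ 2 / (4 * (π' p + 1 : ℕ))))) atTop
          (𝓝 0) := by
    intro π' hπ'
    rw [Metric.tendsto_nhds]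
    intro ε hε
    have h1 := ((tendsto_add_atTop_nat 1).comp hπ').eventually (cosCoeff_local_limit hε)
    filter_upwards [h1] with p hp
    rw [Real.dist_eq, sub_zero]
    simpa using hp ⌈x * cutScale p.1 p.2⌉₊
  have ha := hδ Prod.fst (by rw [← prod_atTop_atTop_eq]; exact tendsto_fst)
  have hb := hδ Prod.snd (by rw [← prod_atTop_atTop_eq]; exact tendsto_snd)
  set C₀ := √(3 * Real.pi) / 2 with hC₀
  have hC₀0 : 0 ≤ C₀ := by positivity
  set C₁ := √(Real.pi / (1 / Real.pi ^ 2)) / 2 with hC₁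
  have hlim : Tendsto (fun p : ℕ × ℕ => coeffProd p.1 p.2 ⌈x * cutScale p.1 p.2⌉₊ -
      3 * Real.pi / 4 * Real.exp (-(1 / 2) *
        ((⌈x * cutScale p.1 p.2⌉₊ : ℝ) / cutScale p.1 p.2) ^ 2)) atTop (𝓝 0) := by
    have hb' := (hb.abs.const_mul C₁).add (ha.abs.const_mul C₀)
    rw [abs_zero, mul_zero, mul_zero, add_zero] at hb'
    refine squeeze_zero_norm (fun p => ?_) hb'
    set k := ⌈x * cutScale p.1 p.2⌉₊
    have hga := abs_sqrt_mul_cosCoeff_le (p.1 + 1) k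
    have hE : C₀ * Real.exp (-(3 * (k : ℝ) ^ 2 / (4 * (p.1 + 1 : ℕ)))) *
        (C₀ * Real.exp (-(3 * (k : ℝ) ^ 2 / (4 * (p.2 + 1 : ℕ))))) =
          3 * Real.pi / 4 * Real.exp (-(1 / 2) * ((k : ℝ) / cutScale p.1 p.2) ^ 2) := by
      rw [mul_mul_mul_comm, ← Real.exp_add]
      have h1 := cutScale_exponent p.1 p.2 k (3 / 4)
      have h2 : C₀ * C₀ = 3 * Real.pi / 4 := by
        rw [hC₀, div_mul_div_comm, Real.mul_self_sqrt (by positivity)]; norm_num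
      rw [h2]
      congr 2
      rw [show -(1 / 2) * ((k : ℝ) / cutScale p.1 p.2) ^ 2 =
        -(2 / 3 * (3 / 4) * ((k : ℝ) / cutScale p.1 p.2) ^ 2) by ring, ← h1]
      field_simp
      ring
    rw [← hE, coeffProd]
    have hEb : |C₀ * Real.exp (-(3 * (k : ℝ) ^ 2 / (4 * (p.2 + 1 : ℕ))))| ≤ C₀ := by
      rw [abs_of_nonneg (by positivity)]
      refine mul_le_of_le_one_right hC₀0 (Real.exp_le_one_iff.2 ?_)
      rw [neg_nonpos]; positivity
    generalize √(p.1 + 1 : ℕ) * cosCoeff (p.1 + 1) k = u at *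
    generalize √(p.2 + 1 : ℕ) * cosCoeff (p.2 + 1) k = v at *
    generalize C₀ * Real.exp (-(3 * (k : ℝ) ^ 2 / (4 * (p.1 + 1 : ℕ)))) = U at *
    generalize C₀ * Real.exp (-(3 * (k : ℝ) ^ 2 / (4 * (p.2 + 1 : ℕ)))) = V at *
    rw [Real.norm_eq_abs, show u * v - U * V = u * (v - V) + V * (u - U) by ring]
    refine (abs_add_le _ _).trans ?_
    rw [abs_mul, abs_mul]
    exact add_le_add (mul_le_mul_of_nonneg_right hga (abs_nonneg _))
      (mul_le_mul_of_nonneg_right hEb (abs_nonneg _))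
  have hexp : Tendsto (fun p : ℕ × ℕ => 3 * Real.pi / 4 * Real.exp (-(1 / 2) *
        ((⌈x * cutScale p.1 p.2⌉₊ : ℝ) / cutScale p.1 p.2) ^ 2)) atTop
      (𝓝 (3 * Real.pi / 4 * Real.exp (-(1 / 2) * x ^ 2))) :=
    ((Real.continuous_exp.tendsto _).comp ((hk.pow 2).const_mul _)).const_mul _
  have := (hk.pow 2).mul (hlim.add hexp)
  simp only [sub_add_cancel, zero_add] at this
  rw [show 3 * Real.pi / 4 * (x ^ 2 * Real.exp (-(1 / 2) * x ^ 2)) =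
    x ^ 2 * (3 * Real.pi / 4 * Real.exp (-(1 / 2) * x ^ 2)) by ring]
  exact this

theorem ceil_pos_of_pos {a b : ℕ} {x : ℝ} (hx : 0 < x) : 0 < ⌈x * cutScale a b⌉₊ :=
  Nat.ceil_pos.2 (mul_pos hx (cutScale_pos a b))

theorem profile_nonneg (a b : ℕ) {x : ℝ} (hx : 0 < x) : 0 ≤ profile a b x := by
  obtain ⟨m, hm⟩ : ∃ m, ⌈x * cutScale a b⌉₊ = m + 1 :=
    ⟨⌈x * cutScale a b⌉₊ - 1, by have := ceil_pos_of_pos (a := a) (b := b) hx; omega⟩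
  rw [profile, hm, coeffProd]
  have h1 := cosCoeff_nonneg a m
  have h2 := cosCoeff_nonneg b m
  push_cast
  positivity

/-- A Gaussian bound for the profile, uniform in `a` and `b`. -/
theorem exists_profile_le : ∃ D : ℝ, 0 < D ∧ ∀ (a b : ℕ) (x : ℝ), 0 < x →
    profile a b x ≤ D * Real.exp (-(1 / 24) * x ^ 2) := by
  obtain ⟨C, hC, h⟩ := exists_sqrt_mul_cosCoeff_le
  refine ⟨48 * C ^ 2, by positivity, fun a b x hx => ?_⟩
  have hs := cutScale_pos a b
  set k := ⌈x * cutScale a b⌉₊ with hk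
  have hk0 : 0 < k := ceil_pos_of_pos hx
  obtain ⟨m, hm⟩ : ∃ m, k = m + 1 := ⟨k - 1, by omega⟩
  have h1 := h (a + 1) (by omega) k
  have h2 := h (b + 1) (by omega) k
  have hb0 : 0 ≤ √(b + 1 : ℕ) * cosCoeff (b + 1) k := by
    rw [hm]; have := cosCoeff_nonneg b m; push_cast; positivity
  have hprod : coeffProd a b k ≤ C ^ 2 * Real.exp (-(1 / 12) * (k / cutScale a b) ^ 2) := by
    refine (mul_le_mul h1 h2 hb0 (by positivity)).trans_eq ?_
    rw [mul_mul_mul_comm, ← Real.exp_add, ← sq]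
    have h3 := cutScale_exponent a b k (1 / 8)
    congr 2
    rw [show -(1 / 12) * ((k : ℝ) / cutScale a b) ^ 2 =
      -(2 / 3 * (1 / 8) * ((k : ℝ) / cutScale a b) ^ 2) by ring, ← h3]
    field_simp
    ring
  have hlow : x ≤ k / cutScale a b := by
    rw [le_div_iff₀ hs]; exact Nat.le_ceil _
  have hup : (k : ℝ) / cutScale a b ≤ x + 2 := by
    have h4 : (k : ℝ) < x * cutScale a b + 1 := Nat.ceil_lt_add_one (by positivity)
    have h5 := inv_cutScale_le a b
    rw [div_le_iff₀ hs] at h5 ⊢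
    nlinarith
  have hy0 : 0 ≤ (k : ℝ) / cutScale a b := by positivity
  -- one half of the Gaussian factor absorbs the polynomial factor `(k/s)² ≤ (x + 2)²`
  have hE : Real.exp (-(1 / 12) * (k / cutScale a b) ^ 2) ≤
      Real.exp (-(1 / 24) * x ^ 2) * Real.exp (-(1 / 24) * x ^ 2) := by
    rw [← Real.exp_add]
    apply Real.exp_le_exp.2
    nlinarith
  have hpoly : ((k : ℝ) / cutScale a b) ^ 2 * Real.exp (-(1 / 24) * x ^ 2) ≤ 48 := by
    have h6 := Real.add_one_le_exp (1 / 24 * x ^ 2)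
    have h7 : ((k : ℝ) / cutScale a b) ^ 2 ≤ 48 * Real.exp (1 / 24 * x ^ 2) := by
      nlinarith [sq_nonneg (x - 2)]
    calc _ ≤ 48 * Real.exp (1 / 24 * x ^ 2) * Real.exp (-(1 / 24) * x ^ 2) :=
          mul_le_mul_of_nonneg_right h7 (Real.exp_pos _).le
      _ = 48 := by rw [mul_assoc, ← Real.exp_add]; simp
  calc profile a b x ≤ (k / cutScale a b) ^ 2 * (C ^ 2 *
        (Real.exp (-(1 / 24) * x ^ 2) * Real.exp (-(1 / 24) * x ^ 2))) := by
        refine mul_le_mul_of_nonneg_left (hprod.trans ?_) (by positivity)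
        exact mul_le_mul_of_nonneg_left hE (by positivity)
    _ = C ^ 2 * ((k / cutScale a b) ^ 2 * Real.exp (-(1 / 24) * x ^ 2)) *
        Real.exp (-(1 / 24) * x ^ 2) := by ring
    _ ≤ C ^ 2 * 48 * Real.exp (-(1 / 24) * x ^ 2) := by gcongr
    _ = _ := by ring

theorem measurable_comp_ceil (v : ℕ → ℝ) (s : ℝ) : Measurable fun x : ℝ => v ⌈x * s⌉₊ :=
  (measurable_from_nat (f := v)).comp (Nat.measurable_ceil.comp (measurable_id.mul_const s))

theorem measurable_profile (a b : ℕ) : Measurable (profile a b) :=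
  measurable_comp_ceil (fun k => ((k : ℝ) / cutScale a b) ^ 2 * coeffProd a b k) _

/-- A sum is the integral of a step function. -/
theorem integral_comp_ceil {s : ℝ} (hs : 0 < s) (v : ℕ → ℝ) {K : ℕ} (hv : ∀ m, K ≤ m → v m = 0) :
    ∫ x in Set.Ioi (0 : ℝ), v (⌈x * s⌉₊ - 1) = 1 / s * ∑ m ∈ Finset.range K, v m := by
  have h1 : ∀ x ∈ Set.Ioi (0 : ℝ), v (⌈x * s⌉₊ - 1) = ∑ m ∈ Finset.range K,
      (Set.Ioc (m / s) ((m + 1) / s)).indicator (fun _ => v m) x := by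
    intro x hx
    have hpos : 0 < ⌈x * s⌉₊ := Nat.ceil_pos.2 (mul_pos hx hs)
    have hmem : ∀ m : ℕ, x ∈ Set.Ioc (m / s) ((m + 1) / s) ↔ ⌈x * s⌉₊ - 1 = m := by
      intro m
      rw [Set.mem_Ioc, div_lt_iff₀ hs, le_div_iff₀ hs]
      have := Nat.ceil_eq_iff (a := x * s) (n := m + 1) (by omega)
      rw [Nat.add_sub_cancel] at this
      push_cast at this
      rw [← this]
      omega
    simp only [Set.indicator_apply, hmem, Finset.sum_ite_eq, Finset.mem_range]
    split_ifs with h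
    · rfl
    · exact hv _ (by omega)
  rw [setIntegral_congr_fun measurableSet_Ioi h1, integral_finsetSum]
  · rw [Finset.mul_sum]
    refine Finset.sum_congr rfl fun m _ => ?_
    have hsub : Set.Ioc ((m : ℝ) / s) ((m + 1) / s) ⊆ Set.Ioi 0 :=
      fun x hx => lt_of_le_of_lt (by positivity) hx.1
    rw [setIntegral_indicator measurableSet_Ioc, Set.inter_eq_self_of_subset_right hsub,
      setIntegral_const, measureReal_def, Real.volume_Ioc, ENNReal.toReal_ofReal, smul_eq_mul]
    · ring
    · rw [← sub_div]; simp; positivity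
  · intro m _
    refine (integrable_indicator_iff measurableSet_Ioc).2 ?_
    refine (integrableOn_const (by simp)).mono_measure Measure.restrict_le_self

/-- The density of the Maxwell distribution; it is used on `x > 0` only. -/
noncomputable def maxwell (x : ℝ) : ℝ :=
  √(2 / Real.pi) * (x ^ 2 * Real.exp (-(1 / 2) * x ^ 2))

theorem integral_rpow_mul_gaussian {κ b : ℝ} (hκ : -1 < κ) (hb : 0 < b) :
    ∫ x in Set.Ioi (0 : ℝ), x ^ κ * Real.exp (-b * x ^ 2) =
      b ^ (-(κ + 1) / 2) * (1 / 2) * Real.Gamma ((κ + 1) / 2) := by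
  have := integral_rpow_mul_exp_neg_mul_rpow (p := 2) (q := κ) (b := b) (by norm_num) hκ hb
  simpa using this

theorem integral_sq_mul_gaussian :
    ∫ x in Set.Ioi (0 : ℝ), x ^ 2 * Real.exp (-(1 / 2) * x ^ 2) = 1 / √(2 / Real.pi) := by
  have h := integral_rpow_mul_gaussian (κ := 2) (b := 1 / 2) (by norm_num) (by norm_num)
  simp only [Real.rpow_ofNat] at h
  rw [h]
  have hG : Real.Gamma ((2 + 1) / 2) = 1 / 2 * √Real.pi := by
    rw [show ((2 : ℝ) + 1) / 2 = 1 / 2 + 1 by norm_num, Real.Gamma_add_one (by norm_num),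
      Real.Gamma_one_half_eq]
  have h2 : ((1 : ℝ) / 2) ^ (-(2 + 1) / 2 : ℝ) = 2 * √2 := by
    rw [one_div, Real.inv_rpow (by norm_num), ← Real.rpow_neg (by norm_num),
      show (-(-(2 + 1) / 2) : ℝ) = 1 + 1 / 2 by norm_num, Real.rpow_add (by norm_num),
      Real.rpow_one, ← Real.sqrt_eq_rpow]
  rw [hG, h2, Real.sqrt_div (by norm_num), one_div_div]
  have : √(2 : ℝ) * √2 = 2 := Real.mul_self_sqrt (by norm_num)
  have h3 : √(2 : ℝ) ≠ 0 := by positivity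
  field_simp
  linarith

theorem integral_maxwell : ∫ x in Set.Ioi (0 : ℝ), maxwell x = 1 := by
  unfold maxwell
  rw [integral_const_mul, integral_sq_mul_gaussian]
  have : √(2 / Real.pi) ≠ 0 := by have := Real.pi_pos; positivity
  field_simp

/-- The Schmidt probabilities as a probability density on the scale `cutScale a b`. -/
noncomputable def schmidtDensity (a b : ℕ) (x : ℝ) : ℝ :=
  cutScale a b * schmidtProb a b (⌈x * cutScale a b⌉₊ - 1)

theorem sum_comp_schmidtProb (a b : ℕ) (F : ℝ → ℝ) (hF : F 0 = 0) :
    ∑ m ∈ Finset.range (min a b + 1), F (cutScale a b * schmidtProb a b m) =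
      cutScale a b * ∫ x in Set.Ioi (0 : ℝ), F (schmidtDensity a b x) := by
  have hs := cutScale_pos a b
  unfold schmidtDensity
  rw [integral_comp_ceil hs (fun m => F (cutScale a b * schmidtProb a b m)) (K := min a b + 1)]
  · field_simp
  · intro m hm
    rw [schmidtProb_eq_zero (by omega), mul_zero, hF]

/-- The density is the normalized profile, because it integrates to `1`. -/
theorem schmidtDensity_eq (a b : ℕ) {x : ℝ} (hx : 0 < x) :
    schmidtDensity a b x = profile a b x / ∫ y in Set.Ioi (0 : ℝ), profile a b y := by
  obtain ⟨c, hc, h⟩ := exists_schmidtProb_eq a b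
  have hs := cutScale_pos a b
  have h1 : ∀ y ∈ Set.Ioi (0 : ℝ),
      schmidtDensity a b y = c * cutScale a b ^ 3 * profile a b y := by
    intro y hy
    have := ceil_pos_of_pos (a := a) (b := b) hy
    rw [schmidtDensity, h, Nat.sub_add_cancel (by omega), profile]
    field_simp
  have h2 := sum_comp_schmidtProb a b id rfl
  simp only [id] at h2
  rw [← Finset.mul_sum, sum_schmidtProb, setIntegral_congr_fun measurableSet_Ioi h1,
    integral_const_mul] at h2
  have h3 : c * cutScale a b ^ 3 * ∫ y in Set.Ioi (0 : ℝ), profile a b y = 1 := by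
    have := mul_left_cancel₀ hs.ne' h2
    linarith
  have h4 : (∫ y in Set.Ioi (0 : ℝ), profile a b y) ≠ 0 := by
    intro h0; rw [h0, mul_zero] at h3; exact zero_ne_one h3
  rw [h1 x hx, eq_div_iff h4, mul_right_comm, h3, one_mul]

theorem tendsto_integral_profile :
    Tendsto (fun p : ℕ × ℕ => ∫ x in Set.Ioi (0 : ℝ), profile p.1 p.2 x) atTop
      (𝓝 (3 * Real.pi / 4 * (1 / √(2 / Real.pi)))) := by
  obtain ⟨D, hD, h⟩ := exists_profile_le
  rw [← integral_sq_mul_gaussian, ← integral_const_mul]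
  refine tendsto_integral_filter_of_dominated_convergence
    (fun x => D * Real.exp (-(1 / 24) * x ^ 2)) ?_ ?_ ?_ ?_
  · exact Eventually.of_forall fun p => (measurable_profile p.1 p.2).aestronglyMeasurable
  · refine Eventually.of_forall fun p => ?_
    filter_upwards [ae_restrict_mem measurableSet_Ioi] with x hx
    rw [Real.norm_of_nonneg (profile_nonneg _ _ hx)]
    exact h _ _ _ hx
  · exact (integrableOn_gaussian (by norm_num)).const_mul D
  · filter_upwards [ae_restrict_mem measurableSet_Ioi] with x hx
    exact tendsto_profile hx

theorem tendsto_schmidtDensity {x : ℝ} (hx : 0 < x) :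
    Tendsto (fun p : ℕ × ℕ => schmidtDensity p.1 p.2 x) atTop (𝓝 (maxwell x)) := by
  have hpi := Real.pi_pos
  have h2 : 0 < √(2 / Real.pi) := by positivity
  have h := (tendsto_profile hx).div tendsto_integral_profile (by positivity)
  have h3 : 3 * Real.pi / 4 * (x ^ 2 * Real.exp (-(1 / 2) * x ^ 2)) /
      (3 * Real.pi / 4 * (1 / √(2 / Real.pi))) = maxwell x := by
    rw [maxwell]
    field_simp
  rw [h3] at h
  exact h.congr fun p => (schmidtDensity_eq p.1 p.2 hx).symm

theorem exists_schmidtDensity_le : ∃ D : ℝ, 0 < D ∧ ∀ᶠ p : ℕ × ℕ in atTop, ∀ x : ℝ, 0 < x →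
    0 ≤ schmidtDensity p.1 p.2 x ∧
      schmidtDensity p.1 p.2 x ≤ D * Real.exp (-(1 / 24) * x ^ 2) := by
  have hpi := Real.pi_pos
  obtain ⟨D, hD, h⟩ := exists_profile_le
  have hL : 0 < 3 * Real.pi / 4 * (1 / √(2 / Real.pi)) := by positivity
  set L := 3 * Real.pi / 4 * (1 / √(2 / Real.pi)) with hL'
  refine ⟨D / (L / 2), by positivity, ?_⟩
  filter_upwards [tendsto_integral_profile.eventually (lt_mem_nhds (half_lt_self hL))] with p hp x hx
  rw [schmidtDensity_eq _ _ hx, div_mul_eq_mul_div]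
  have hp0 := profile_nonneg p.1 p.2 hx
  have hL2 : 0 < L / 2 := by positivity
  exact ⟨div_nonneg hp0 (hL2.trans hp).le,
    div_le_div₀ (by positivity) (h _ _ _ hx) hL2 hp.le⟩

/-- A continuous function that is `O(y ^ δ)` on bounded sets of `y ≥ 0`, for some `δ > 0`. Such a
function turns a Gaussian bound into a Gaussian bound. -/
structure RpowBounded (F : ℝ → ℝ) : Prop where
  continuous : Continuous F
  bound : ∃ δ : ℝ, 0 < δ ∧ ∀ M : ℝ, 0 < M → ∃ C : ℝ, 0 ≤ C ∧
    ∀ y, 0 ≤ y → y ≤ M → |F y| ≤ C * y ^ δ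

/-- The exponent `1/24` is that of the Gaussian bound for the Schmidt density. -/
theorem RpowBounded.exists_abs_le {F : ℝ → ℝ} (hF : RpowBounded F) {D : ℝ} (hD : 0 < D) :
    ∃ C c : ℝ, 0 < c ∧ ∀ x y : ℝ, 0 ≤ y → y ≤ D * Real.exp (-(1 / 24) * x ^ 2) →
      |F y| ≤ C * Real.exp (-c * x ^ 2) := by
  obtain ⟨δ, hδ, h⟩ := hF.bound
  obtain ⟨C, hC, hb⟩ := h D hD
  refine ⟨C * D ^ δ, δ / 24, by positivity, fun x y h1 h2 => ?_⟩
  have h3 : y ≤ D := h2.trans (mul_le_of_le_one_right hD.le (Real.exp_le_one_iff.2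
    (by nlinarith [sq_nonneg x])))
  refine (hb y h1 h3).trans ?_
  have h4 := Real.rpow_le_rpow h1 h2 hδ.le
  rw [Real.mul_rpow hD.le (Real.exp_pos _).le, ← Real.exp_mul] at h4
  rw [mul_assoc]
  refine mul_le_mul_of_nonneg_left (h4.trans_eq ?_) hC
  ring_nf

theorem measurable_schmidtDensity (a b : ℕ) : Measurable (schmidtDensity a b) :=
  measurable_comp_ceil (fun k => cutScale a b * schmidtProb a b (k - 1)) _

/-- Integrals of functions of the Schmidt density converge to those of the Maxwell density. -/
theorem RpowBounded.tendsto_integral {F : ℝ → ℝ} (hF : RpowBounded F) :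
    Tendsto (fun p : ℕ × ℕ => ∫ x in Set.Ioi (0 : ℝ), F (schmidtDensity p.1 p.2 x)) atTop
      (𝓝 (∫ x in Set.Ioi (0 : ℝ), F (maxwell x))) := by
  obtain ⟨D, hD, h⟩ := exists_schmidtDensity_le
  obtain ⟨C, c, hc, hb⟩ := hF.exists_abs_le hD
  refine tendsto_integral_filter_of_dominated_convergence
    (fun x => C * Real.exp (-c * x ^ 2)) ?_ ?_ ?_ ?_
  · exact Eventually.of_forall fun p =>
      (hF.continuous.measurable.comp (measurable_schmidtDensity p.1 p.2)).aestronglyMeasurable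
  · filter_upwards [h] with p hp
    filter_upwards [ae_restrict_mem measurableSet_Ioi] with x hx
    exact hb x _ (hp x hx).1 (hp x hx).2
  · exact (integrableOn_gaussian hc).const_mul C
  · filter_upwards [ae_restrict_mem measurableSet_Ioi] with x hx
    exact (hF.continuous.tendsto _).comp (tendsto_schmidtDensity hx)

theorem maxwell_nonneg (x : ℝ) : 0 ≤ maxwell x := by
  unfold maxwell; positivity

theorem maxwell_le {x : ℝ} : maxwell x ≤ 24 * Real.exp (-(1 / 24) * x ^ 2) := by
  have hpi := Real.pi_gt_three
  have h1 : √(2 / Real.pi) ≤ 1 := by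
    refine Real.sqrt_le_one.2 ?_
    rw [div_le_one (by positivity)]; linarith
  have h2 := Real.add_one_le_exp (1 / 24 * x ^ 2)
  have h3 : x ^ 2 ≤ 24 * Real.exp (1 / 24 * x ^ 2) := by linarith
  have h4 : x ^ 2 * Real.exp (-(1 / 2) * x ^ 2) ≤ 24 * Real.exp (-(1 / 24) * x ^ 2) := by
    refine (mul_le_mul_of_nonneg_right h3 (Real.exp_pos _).le).trans ?_
    rw [mul_assoc, ← Real.exp_add]
    refine mul_le_mul_of_nonneg_left (Real.exp_le_exp.2 ?_) (by norm_num)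
    nlinarith [sq_nonneg x]
  unfold maxwell
  exact (mul_le_of_le_one_left (by positivity) h1).trans h4

theorem continuous_maxwell : Continuous maxwell := by
  unfold maxwell; fun_prop

theorem RpowBounded.integrableOn_maxwell {F : ℝ → ℝ} (hF : RpowBounded F) :
    IntegrableOn (fun x => F (maxwell x)) (Set.Ioi 0) := by
  obtain ⟨C, c, hc, hb⟩ := hF.exists_abs_le (D := 24) (by norm_num)
  exact Integrable.mono' ((integrableOn_gaussian hc).const_mul C)
    (hF.continuous.comp continuous_maxwell).aestronglyMeasurable
    (Eventually.of_forall fun x => hb x _ (maxwell_nonneg x) maxwell_le)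

theorem rpowBounded_rpow {κ : ℝ} (hκ : 0 < κ) : RpowBounded fun y => y ^ κ where
  continuous := Real.continuous_rpow_const hκ.le
  bound := ⟨κ, hκ, fun M _ => ⟨1, zero_le_one, fun y hy _ => by
    rw [abs_of_nonneg (Real.rpow_nonneg hy _), one_mul]⟩⟩

theorem rpowBounded_negMulLog : RpowBounded Real.negMulLog where
  continuous := Real.continuous_negMulLog
  bound := by
    refine ⟨1 / 2, by norm_num, fun M hM => ⟨2 + M ^ 2, by positivity, fun y hy hyM => ?_⟩⟩
    rcases hy.eq_or_lt with rfl | hy0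
    · simp
    have hr : 0 < y ^ (1 / 2 : ℝ) := Real.rpow_pos_of_pos hy0 _
    rw [Real.negMulLog, abs_mul, abs_neg, abs_of_pos hy0]
    rcases le_total y 1 with h | h
    · have h1 := (Real.abs_log_mul_self_rpow_lt y (1 / 2) hy0 h (by norm_num)).le
      rw [abs_mul, abs_of_pos hr] at h1
      have h2 : y = y ^ (1 / 2 : ℝ) * y ^ (1 / 2 : ℝ) := by
        rw [← Real.rpow_add hy0]; norm_num
      calc y * |Real.log y| = (|Real.log y| * y ^ (1 / 2 : ℝ)) * y ^ (1 / 2 : ℝ) := by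
            rw [mul_assoc, ← h2, mul_comm]
        _ ≤ (2 + M ^ 2) * y ^ (1 / 2 : ℝ) := by
            refine mul_le_mul_of_nonneg_right ?_ hr.le
            norm_num at h1
            nlinarith [sq_nonneg M]
    · have h1 : 1 ≤ y ^ (1 / 2 : ℝ) := Real.one_le_rpow h (by norm_num)
      rw [abs_of_nonneg (Real.log_nonneg h)]
      have h2 := Real.log_le_sub_one_of_pos hy0
      have h3 : y * Real.log y ≤ M ^ 2 := by nlinarith [Real.log_nonneg h]
      nlinarith [sq_nonneg M]

end

/-! ### Entropies of the Maxwell distribution -/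

section
open MeasureTheory Filter Topology

theorem integral_maxwell_rpow {κ : ℝ} (hκ : 0 < κ) :
    ∫ x in Set.Ioi (0 : ℝ), maxwell x ^ κ =
      (2 / Real.pi) ^ (κ / 2) * ((κ / 2) ^ (-(κ + 1 / 2)) * (1 / 2) * Real.Gamma (κ + 1 / 2)) := by
  have hpi := Real.pi_pos
  have h1 : ∀ x ∈ Set.Ioi (0 : ℝ), maxwell x ^ κ =
      (2 / Real.pi) ^ (κ / 2) * (x ^ (2 * κ) * Real.exp (-(κ / 2) * x ^ 2)) := by
    intro x hx
    have hx' : (0 : ℝ) ≤ x := (Set.mem_Ioi.1 hx).le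
    rw [maxwell, Real.mul_rpow (by positivity) (by positivity),
      Real.mul_rpow (by positivity) (Real.exp_pos _).le, ← Real.exp_mul, Real.sqrt_eq_rpow,
      ← Real.rpow_mul (by positivity), ← Real.rpow_natCast, ← Real.rpow_mul hx']
    push_cast
    ring_nf
  rw [setIntegral_congr_fun measurableSet_Ioi h1, integral_const_mul,
    integral_rpow_mul_gaussian (by linarith) (by positivity)]
  congr 2
  · congr 2; ring
  · congr 1; ring

theorem integral_maxwell_rpow_pos {κ : ℝ} (hκ : 0 < κ) :
    0 < ∫ x in Set.Ioi (0 : ℝ), maxwell x ^ κ := by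
  rw [integral_maxwell_rpow hκ]
  have := Real.pi_pos
  have := Real.Gamma_pos_of_pos (show 0 < κ + 1 / 2 by linarith)
  positivity

theorem log_integral_maxwell_rpow {κ : ℝ} (hκ : 0 < κ) (hκ1 : κ ≠ 1) :
    1 / (1 - κ) * Real.log (∫ x in Set.Ioi (0 : ℝ), maxwell x ^ κ) - 1 / 2 * Real.log 3 =
      renyiConst κ := by
  have hpi := Real.pi_pos
  have hG := Real.Gamma_pos_of_pos (show 0 < κ + 1 / 2 by linarith)
  rw [integral_maxwell_rpow hκ, Real.log_mul (by positivity) (by positivity),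
    Real.log_mul (by positivity) hG.ne', Real.log_mul (by positivity) (by norm_num),
    Real.log_rpow (by positivity), Real.log_rpow (by positivity),
    Real.log_div (by norm_num) hpi.ne', Real.log_div hκ.ne' (by norm_num), renyiConst,
    Real.log_div hpi.ne' (by norm_num), one_div (2 : ℝ), Real.log_inv,
    show (24 : ℝ) = 2 ^ 3 * 3 by norm_num, show (6 : ℝ) = 2 * 3 by norm_num,
    Real.log_mul (by norm_num) (by norm_num), Real.log_mul (by norm_num) (by norm_num),
    Real.log_pow]
  have h1 : 1 - κ ≠ 0 := sub_ne_zero.2 hκ1.symm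
  push_cast
  field_simp
  ring

/-- The derivative of the Gamma function at `3/2`, as an integral and in closed form, obtained from
that at `1/2` by `Γ(x + 1) = x Γ(x)`. -/
theorem integral_log_mul_sqrt_mul_exp :
    ∫ t in Set.Ioi (0 : ℝ), t ^ (1 / 2 : ℝ) * (Real.log t * Real.exp (-t)) =
      √Real.pi * (1 - Real.eulerMascheroniConstant / 2 - Real.log 2) := by
  have h32 : (0 : ℝ) < (3 / 2 : ℂ).re := by norm_num
  have h1 : HasDerivAt Complex.Gamma
      (∫ t : ℝ in Set.Ioi 0, (t : ℂ) ^ ((3 / 2 : ℂ) - 1) * (Real.log t * Real.exp (-t)))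
      (3 / 2 : ℂ) := by
    refine (Complex.hasDerivAt_GammaIntegral h32).congr_of_eventuallyEq ?_
    filter_upwards [(isOpen_lt continuous_const Complex.continuous_re).mem_nhds h32] with s hs
    exact Complex.Gamma_eq_integral hs
  have h2 : HasDerivAt (fun x : ℝ => (Complex.Gamma x).re)
      (∫ t : ℝ in Set.Ioi 0,
        (t : ℂ) ^ ((3 / 2 : ℂ) - 1) * (Real.log t * Real.exp (-t))).re (3 / 2) := by
    refine HasDerivAt.real_of_complex ?_
    convert h1 using 1
    norm_num
  have h3 : (∫ t : ℝ in Set.Ioi 0,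
        (t : ℂ) ^ ((3 / 2 : ℂ) - 1) * (Real.log t * Real.exp (-t))) =
      ((∫ t in Set.Ioi (0 : ℝ), t ^ (1 / 2 : ℝ) * (Real.log t * Real.exp (-t)) : ℝ) : ℂ) := by
    rw [← integral_complex_ofReal]
    refine setIntegral_congr_fun measurableSet_Ioi fun t ht => ?_
    have ht' : (0 : ℝ) ≤ t := (Set.mem_Ioi.1 ht).le
    rw [Complex.ofReal_mul, Complex.ofReal_cpow ht', Complex.ofReal_mul]
    norm_num
  rw [h3, Complex.ofReal_re] at h2
  simp only [Complex.Gamma_ofReal, Complex.ofReal_re] at h2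
  have h4 : HasDerivAt (fun x : ℝ => x * Real.Gamma x)
      (1 * Real.Gamma (1 / 2) + 1 / 2 *
        (-√Real.pi * (Real.eulerMascheroniConstant + 2 * Real.log 2))) (1 / 2) :=
    (hasDerivAt_id (1 / 2 : ℝ)).mul Real.hasDerivAt_Gamma_one_half
  have h5 : HasDerivAt (fun x : ℝ => Real.Gamma (x + 1))
      (∫ t in Set.Ioi (0 : ℝ), t ^ (1 / 2 : ℝ) * (Real.log t * Real.exp (-t))) (1 / 2) := by
    have : HasDerivAt Real.Gamma
      (∫ t in Set.Ioi (0 : ℝ), t ^ (1 / 2 : ℝ) * (Real.log t * Real.exp (-t))) (1 / 2 + 1) := by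
      rw [show (1 / 2 + 1 : ℝ) = 3 / 2 by norm_num]; exact h2
    exact this.comp_add_const (1 / 2) 1
  have h6 : (fun x : ℝ => x * Real.Gamma x) =ᶠ[𝓝 (1 / 2)] fun x => Real.Gamma (x + 1) := by
    filter_upwards [eventually_ne_nhds (show (1 / 2 : ℝ) ≠ 0 by norm_num)] with x hx
    exact (Real.Gamma_add_one hx).symm
  rw [(h5.congr_of_eventuallyEq h6).unique h4, Real.Gamma_one_half_eq]
  ring

/-- The expectation of `log (x² / 2)` under the Maxwell distribution, by the substitution
`t = x² / 2`. -/
theorem integral_maxwell_mul_log :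
    ∫ x in Set.Ioi (0 : ℝ), maxwell x * (2 * Real.log x - Real.log 2) =
      2 - Real.eulerMascheroniConstant - 2 * Real.log 2 := by
  have hpi := Real.pi_pos
  set h : ℝ → ℝ := fun t => t ^ (1 / 2 : ℝ) * (Real.log t * Real.exp (-t)) with hh
  have h1 := integral_comp_rpow_Ioi_of_pos (g := fun y => h (1 / 2 * y)) (p := 2) (by norm_num)
  rw [integral_comp_mul_left_Ioi h 0 (by norm_num : (0 : ℝ) < 1 / 2), mul_zero,
    integral_log_mul_sqrt_mul_exp] at h1
  have h2 : ∀ x ∈ Set.Ioi (0 : ℝ), maxwell x * (2 * Real.log x - Real.log 2) =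
      1 / √Real.pi * (((2 : ℝ) * x ^ ((2 : ℝ) - 1)) • h (1 / 2 * x ^ (2 : ℝ))) := by
    intro x hx
    have hx0 : (0 : ℝ) < x := Set.mem_Ioi.1 hx
    have e1 : x ^ ((2 : ℝ) - 1) = x := by norm_num
    have e2 : x ^ (2 : ℝ) = x ^ 2 := Real.rpow_two x
    rw [e1, e2, hh]
    simp only [smul_eq_mul]
    rw [← Real.sqrt_eq_rpow, Real.sqrt_mul (by norm_num), Real.sqrt_sq hx0.le,
      Real.log_mul (by norm_num) (by positivity), Real.log_pow, maxwell,
      Real.sqrt_div (by norm_num), Real.sqrt_div (by norm_num), Real.sqrt_one, one_div (2 : ℝ),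
      Real.log_inv]
    have h3 : √(2 : ℝ) ^ 2 = 2 := Real.sq_sqrt (by norm_num)
    have h4 : √(2 : ℝ) ≠ 0 := by positivity
    have h5 : √Real.pi ≠ 0 := by positivity
    rw [show -((2 : ℝ)⁻¹ * x ^ 2) = -2⁻¹ * x ^ 2 by ring]
    push_cast
    field_simp
    rw [h3]
    ring
  rw [setIntegral_congr_fun measurableSet_Ioi h2, integral_const_mul, h1]
  have h5 : √Real.pi ≠ 0 := by positivity
  simp only [smul_eq_mul]
  field_simp

theorem integral_maxwell_mul_sq :
    ∫ x in Set.Ioi (0 : ℝ), maxwell x * x ^ 2 = 3 := by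
  have hpi := Real.pi_pos
  have h := integral_rpow_mul_gaussian (κ := 4) (b := 1 / 2) (by norm_num) (by norm_num)
  have h2 := integral_rpow_mul_gaussian (κ := 2) (b := 1 / 2) (by norm_num) (by norm_num)
  simp only [Real.rpow_ofNat] at h h2
  rw [integral_sq_mul_gaussian] at h2
  have hG : Real.Gamma ((4 + 1) / 2) = 3 / 2 * Real.Gamma ((2 + 1) / 2) := by
    rw [show ((4 : ℝ) + 1) / 2 = (2 + 1) / 2 + 1 by norm_num, Real.Gamma_add_one (by norm_num)]
    norm_num
  have hp : ((1 : ℝ) / 2) ^ (-(4 + 1) / 2 : ℝ) = 2 * (1 / 2) ^ (-(2 + 1) / 2 : ℝ) := by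
    rw [show (-(4 + 1) / 2 : ℝ) = -1 + -(2 + 1) / 2 by norm_num, Real.rpow_add (by norm_num),
      Real.rpow_neg_one]
    norm_num
  rw [hG, hp, show ∀ u v : ℝ, 2 * u * (1 / 2) * (3 / 2 * v) = 3 * (u * (1 / 2) * v) by
    intros; ring, ← h2] at h
  have h3 : ∀ x : ℝ, maxwell x * x ^ 2 =
      √(2 / Real.pi) * (x ^ 4 * Real.exp (-(1 / 2) * x ^ 2)) := by
    intro x; rw [maxwell]; ring
  simp only [h3]
  rw [integral_const_mul, h]
  have : √(2 / Real.pi) ≠ 0 := by positivity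
  field_simp

theorem integrableOn_maxwell : IntegrableOn maxwell (Set.Ioi 0) := by
  refine Integrable.of_integral_ne_zero ?_
  rw [integral_maxwell]
  exact one_ne_zero

theorem integrableOn_maxwell_mul_sq : IntegrableOn (fun x => maxwell x * x ^ 2) (Set.Ioi 0) := by
  refine Integrable.of_integral_ne_zero ?_
  rw [integral_maxwell_mul_sq]
  norm_num

/-- The differential entropy of the Maxwell distribution. -/
theorem integral_negMulLog_maxwell :
    ∫ x in Set.Ioi (0 : ℝ), Real.negMulLog (maxwell x) =
      Real.eulerMascheroniConstant - 1 / 2 + 1 / 2 * Real.log (2 * Real.pi) := by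
  have hpi := Real.pi_pos
  have h1 : ∀ x ∈ Set.Ioi (0 : ℝ), maxwell x * (2 * Real.log x - Real.log 2) =
      -Real.negMulLog (maxwell x) - (1 / 2 * Real.log (2 / Real.pi) + Real.log 2) * maxwell x
        + 1 / 2 * (maxwell x * x ^ 2) := by
    intro x hx
    have hx0 : (0 : ℝ) < x := Set.mem_Ioi.1 hx
    have h2 : Real.log (maxwell x) =
        1 / 2 * Real.log (2 / Real.pi) + (2 * Real.log x - 1 / 2 * x ^ 2) := by
      rw [maxwell, Real.log_mul (by positivity) (by positivity),
        Real.log_mul (by positivity) (Real.exp_pos _).ne', Real.log_exp, Real.log_pow,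
        Real.log_sqrt (by positivity)]
      push_cast
      ring
    rw [Real.negMulLog, h2]
    ring
  have hi1 : IntegrableOn (fun x => -Real.negMulLog (maxwell x)) (Set.Ioi 0) :=
    rpowBounded_negMulLog.integrableOn_maxwell.neg
  have hi2 : IntegrableOn (fun x => -Real.negMulLog (maxwell x) -
      (1 / 2 * Real.log (2 / Real.pi) + Real.log 2) * maxwell x) (Set.Ioi 0) :=
    hi1.sub (integrableOn_maxwell.const_mul _)
  have h2 := integral_maxwell_mul_log
  rw [setIntegral_congr_fun measurableSet_Ioi h1,
    integral_add hi2 (integrableOn_maxwell_mul_sq.const_mul _),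
    integral_sub hi1 (integrableOn_maxwell.const_mul _), integral_neg, integral_const_mul,
    integral_const_mul, integral_maxwell, integral_maxwell_mul_sq,
    Real.log_div (by norm_num) hpi.ne'] at h2
  rw [Real.log_mul (by norm_num) hpi.ne']
  linarith

end

/-! ### Asymptotics of the entropies -/

section
open MeasureTheory Filter Topology

/-- The length `n₁ (2 n - n₁) / n` that governs the entropies, in terms of the lengths `a = n₁` and
`b = 2 n - n₁` of the two parts. -/
noncomputable def reducedLength (a b : ℕ) : ℝ := 2 * (a * b) / (a + b)

/-- The constant comes from `s² = (2/3) A B / (A + B) ~ (1/3) n₁ (2 n - n₁) / n`. -/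
theorem tendsto_log_cutScale_sub :
    Tendsto (fun p : ℕ × ℕ => Real.log (cutScale p.1 p.2) -
      1 / 2 * Real.log (reducedLength p.1 p.2)) atTop (𝓝 (-(1 / 2 * Real.log 3))) := by
  rw [← prod_atTop_atTop_eq]
  have ha : Tendsto (fun p : ℕ × ℕ => ((p.1 : ℕ) : ℝ)) (atTop ×ˢ atTop) atTop :=
    tendsto_natCast_atTop_atTop.comp tendsto_fst
  have hb : Tendsto (fun p : ℕ × ℕ => ((p.2 : ℕ) : ℝ)) (atTop ×ˢ atTop) atTop :=
    tendsto_natCast_atTop_atTop.comp tendsto_snd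
  have hlog : ∀ {f : ℕ × ℕ → ℝ} (c : ℝ), Tendsto f (atTop ×ˢ atTop) atTop →
      Tendsto (fun p => Real.log (1 + c / f p)) (atTop ×ˢ atTop) (𝓝 0) := by
    intro f c hf
    have h1 : Tendsto (fun p => 1 + c / f p) (atTop ×ˢ atTop) (𝓝 1) := by
      simpa using (hf.const_div_atTop c).const_add 1
    simpa using h1.log one_ne_zero
  have h := ((((hlog 1 ha).add (hlog 1 hb)).sub (hlog 2 (ha.atTop_add_atTop hb))).const_mul
    (1 / 2)).sub_const (1 / 2 * Real.log 3)
  simp only [add_zero, sub_zero, mul_zero, zero_sub] at h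
  refine h.congr' ?_
  filter_upwards [ha.eventually_gt_atTop 0, hb.eventually_gt_atTop 0] with p h1 h2
  rw [cutScale, reducedLength, Real.log_sqrt (by positivity)]
  generalize (p.1 : ℝ) = x at *
  generalize (p.2 : ℝ) = y at *
  rw [one_add_div h1.ne', one_add_div h2.ne', one_add_div (by positivity),
    Real.log_div (by positivity) (by positivity), Real.log_div (by positivity) (by positivity),
    Real.log_div (by positivity) (by positivity), Real.log_div (by positivity) (by positivity),
    Real.log_div (by positivity) (by positivity), Real.log_mul (by positivity) (by positivity),
    Real.log_mul (by positivity) (by positivity), Real.log_mul (by positivity) (by positivity),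
    Real.log_mul (by positivity) (by positivity), Real.log_div (by positivity) (by positivity)]
  ring

/-- Rescaling by `s` adds `log s` to the entropy, which leaves the differential entropy of the
Maxwell distribution in the limit. -/
theorem tendsto_sum_negMulLog_schmidtProb :
    Tendsto (fun p : ℕ × ℕ => ∑ m ∈ Finset.range (min p.1 p.2 + 1),
      Real.negMulLog (schmidtProb p.1 p.2 m) - 1 / 2 * Real.log (reducedLength p.1 p.2)) atTop
      (𝓝 (Real.eulerMascheroniConstant - 1 / 2 + 1 / 2 * Real.log (2 * Real.pi / 3))) := by
  have hpi := Real.pi_pos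
  have h := rpowBounded_negMulLog.tendsto_integral.add tendsto_log_cutScale_sub
  rw [integral_negMulLog_maxwell] at h
  rw [Real.log_div (by positivity) (by norm_num)]
  rw [show ∀ g l : ℝ, g - 1 / 2 + 1 / 2 * (l - Real.log 3) =
    g - 1 / 2 + 1 / 2 * l + -(1 / 2 * Real.log 3) by intros; ring]
  refine h.congr fun p => ?_
  have hs := cutScale_pos p.1 p.2
  have h1 := sum_comp_schmidtProb p.1 p.2 Real.negMulLog (by simp)
  simp only [Real.negMulLog_mul] at h1
  rw [Finset.sum_add_distrib, ← Finset.sum_mul, ← Finset.mul_sum, sum_schmidtProb, one_mul] at h1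
  have h2 : Real.negMulLog (cutScale p.1 p.2) =
      cutScale p.1 p.2 * -Real.log (cutScale p.1 p.2) := by rw [Real.negMulLog]; ring
  rw [h2, ← mul_add] at h1
  have h3 := mul_left_cancel₀ hs.ne' h1
  linarith

/-- Rescaling by `s` multiplies the sum of the `κ`-th powers by `s ^ (κ - 1)`. -/
theorem tendsto_log_sum_rpow_schmidtProb {κ : ℝ} (hκ : 0 < κ) (hκ1 : κ ≠ 1) :
    Tendsto (fun p : ℕ × ℕ => 1 / (1 - κ) * Real.log (∑ m ∈ Finset.range (min p.1 p.2 + 1),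
      schmidtProb p.1 p.2 m ^ κ) - 1 / 2 * Real.log (reducedLength p.1 p.2)) atTop
      (𝓝 (renyiConst κ)) := by
  have h1κ : 1 - κ ≠ 0 := sub_ne_zero.2 hκ1.symm
  have hI := (rpowBounded_rpow hκ).tendsto_integral
  have hpos := integral_maxwell_rpow_pos hκ
  have h := ((hI.log hpos.ne').const_mul (1 / (1 - κ))).add tendsto_log_cutScale_sub
  rw [← log_integral_maxwell_rpow hκ hκ1, sub_eq_add_neg (1 / (1 - κ) * _)]
  refine h.congr' ?_
  filter_upwards [hI.eventually (lt_mem_nhds hpos)] with p hp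
  have hs := cutScale_pos p.1 p.2
  have h1 := sum_comp_schmidtProb p.1 p.2 (fun y => y ^ κ) (Real.zero_rpow hκ.ne')
  have h0 : ∀ m, 0 ≤ schmidtProb p.1 p.2 m := fun m => by unfold schmidtProb; positivity
  have h2 : ∀ m, (cutScale p.1 p.2 * schmidtProb p.1 p.2 m) ^ κ =
      cutScale p.1 p.2 ^ κ * schmidtProb p.1 p.2 m ^ κ :=
    fun m => Real.mul_rpow hs.le (h0 m)
  simp only [h2] at h1
  rw [← Finset.mul_sum] at h1
  have hsκ : 0 < cutScale p.1 p.2 ^ κ := Real.rpow_pos_of_pos hs κ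
  have h3 : ∑ m ∈ Finset.range (min p.1 p.2 + 1), schmidtProb p.1 p.2 m ^ κ ≠ 0 := by
    intro h4
    rw [h4, mul_zero] at h1
    exact (mul_pos hs hp).ne h1
  have h5 := congrArg Real.log h1
  rw [Real.log_mul hsκ.ne' h3, Real.log_mul hs.ne' hp.ne', Real.log_rpow hs] at h5
  have h6 : Real.log (∑ m ∈ Finset.range (min p.1 p.2 + 1), schmidtProb p.1 p.2 m ^ κ) =
      Real.log (∫ x in Set.Ioi (0 : ℝ), schmidtDensity p.1 p.2 x ^ κ) +
        (1 - κ) * Real.log (cutScale p.1 p.2) := by linarith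
  rw [h6, mul_add, ← mul_assoc, one_div_mul_cancel h1κ, one_mul]
  ring

theorem vonNeumannNats_rhoCut (a b : ℕ) :
    vonNeumannNats (rhoCut a b) =
      ∑ m ∈ Finset.range (min a b + 1), Real.negMulLog (schmidtProb a b m) := by
  rw [vonNeumannNats, trace_rhoCut_mul_cfc, Complex.ofReal_re, ← Finset.sum_neg_distrib]
  simp [Real.negMulLog]

theorem vonNeumannBits_rhoCut (a b : ℕ) :
    vonNeumannBits (rhoCut a b) = vonNeumannNats (rhoCut a b) / Real.log 2 := by
  rw [vonNeumannBits, vonNeumannNats, trace_rhoCut_mul_cfc, trace_rhoCut_mul_cfc,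
    Complex.ofReal_re, Complex.ofReal_re, neg_div, Finset.sum_div]
  simp only [Real.logb, mul_div_assoc]

theorem renyiNats_rhoCut {κ : ℝ} (hκ : 0 < κ) (a b : ℕ) :
    renyiNats κ (rhoCut a b) = 1 / (1 - κ) *
      Real.log (∑ m ∈ Finset.range (min a b + 1), schmidtProb a b m ^ κ) := by
  rw [renyiNats, trace_cfc_rhoCut a b (fun x => x ^ κ) (Real.zero_rpow hκ.ne'), Complex.ofReal_re]

theorem renyiBits_eq {ι : Type*} [Fintype ι] [DecidableEq ι] (κ : ℝ) (ρ : Matrix ι ι ℂ) :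
    renyiBits κ ρ = renyiNats κ ρ / Real.log 2 := by
  rw [renyiBits, renyiNats, Real.logb, mul_div_assoc]

theorem cutAsymptotic_of_tendsto {S A : ℕ → ℕ → ℝ} {c : ℝ}
    (h : Tendsto (fun p : ℕ × ℕ => S p.1 p.2 - 1 / 2 * Real.log (reducedLength p.1 p.2)) atTop
      (𝓝 c))
    (hA : ∀ n n₁ : ℕ, A n n₁ = 1 / 2 * Real.log ((n₁ : ℝ) * (2 * n - n₁) / n) + c) :
    CutAsymptotic S A := by
  intro ε hε
  obtain ⟨⟨K₁, K₂⟩, hK⟩ := Filter.eventually_atTop.1 (Metric.tendsto_nhds.1 h ε hε)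
  refine ⟨max K₁ K₂, fun n n₁ n₂ hn h₁ h₂ => ?_⟩
  have := hK (n₁, n₂) ⟨(le_max_left _ _).trans h₁, (le_max_right _ _).trans h₂⟩
  have hn' : (n₁ : ℝ) + n₂ = 2 * n := by exact_mod_cast hn
  have hl : reducedLength n₁ n₂ = (n₁ : ℝ) * (2 * n - n₁) / n := by
    rw [reducedLength, hn', ← hn', add_sub_cancel_left, hn', mul_div_mul_left _ _ two_ne_zero]
  rw [Real.dist_eq] at this
  rw [hA, ← hl]
  rwa [← sub_sub]

theorem CutAsymptotic.div_const {S A : ℕ → ℕ → ℝ} (h : CutAsymptotic S A) {c : ℝ} (hc : 0 < c) :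
    CutAsymptotic (fun a b => S a b / c) (fun n a => A n a / c) := by
  intro ε hε
  obtain ⟨K, hK⟩ := h (ε * c) (mul_pos hε hc)
  refine ⟨K, fun n n₁ n₂ hn h₁ h₂ => ?_⟩
  rw [← sub_div, abs_div, abs_of_pos hc, div_lt_iff₀ hc]
  exact hK n n₁ n₂ hn h₁ h₂

theorem cutAsymptotic_vonNeumannNats :
    CutAsymptotic (fun n₁ n₂ => vonNeumannNats (rhoCut n₁ n₂))
      (fun n n₁ => 1 / 2 * Real.log ((n₁ : ℝ) * (2 * n - n₁) / n)
        + Real.eulerMascheroniConstant - 1 / 2 + 1 / 2 * Real.log (2 * Real.pi / 3)) := by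
  refine cutAsymptotic_of_tendsto (c := Real.eulerMascheroniConstant - 1 / 2
    + 1 / 2 * Real.log (2 * Real.pi / 3)) ?_ fun n n₁ => by ring
  simp only [vonNeumannNats_rhoCut]
  exact tendsto_sum_negMulLog_schmidtProb

theorem cutAsymptotic_vonNeumannBits :
    CutAsymptotic (fun n₁ n₂ => vonNeumannBits (rhoCut n₁ n₂))
      (fun n n₁ => 1 / 2 * Real.logb 2 ((n₁ : ℝ) * (2 * n - n₁) / n)
        + (Real.eulerMascheroniConstant - 1 / 2) * Real.logb 2 (Real.exp 1)
        + 1 / 2 * Real.logb 2 (2 * Real.pi / 3)) := by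
  have h := cutAsymptotic_vonNeumannNats.div_const (Real.log_pos one_lt_two)
  simp only [vonNeumannBits_rhoCut]
  convert h using 3
  simp only [Real.logb, Real.log_exp]
  ring

theorem cutAsymptotic_renyiNats {κ : ℝ} (hκ : 0 < κ) (hκ1 : κ ≠ 1) :
    CutAsymptotic (fun n₁ n₂ => renyiNats κ (rhoCut n₁ n₂))
      (fun n n₁ => 1 / 2 * Real.log ((n₁ : ℝ) * (2 * n - n₁) / n) + renyiConst κ) := by
  refine cutAsymptotic_of_tendsto (c := renyiConst κ) ?_ fun n n₁ => rfl
  simp only [renyiNats_rhoCut hκ]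
  exact tendsto_log_sum_rpow_schmidtProb hκ hκ1

theorem cutAsymptotic_renyiBits {κ : ℝ} (hκ : 0 < κ) (hκ1 : κ ≠ 1) :
    CutAsymptotic (fun n₁ n₂ => renyiBits κ (rhoCut n₁ n₂))
      (fun n n₁ => 1 / 2 * Real.logb 2 ((n₁ : ℝ) * (2 * n - n₁) / n)
        + renyiConst κ * Real.logb 2 (Real.exp 1)) := by
  have h := (cutAsymptotic_renyiNats hκ hκ1).div_const (Real.log_pos one_lt_two)
  simp only [renyiBits_eq]
  convert h using 3
  simp only [Real.logb, Real.log_exp]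
  ring

theorem tendsto_half_chain :
    Tendsto (fun n : ℕ => vonNeumannBits (rhoCut n n) -
        (1 / 2 * Real.logb 2 n
          + (Real.eulerMascheroniConstant - 1 / 2) * Real.logb 2 (Real.exp 1)
          + 1 / 2 * Real.logb 2 (2 * Real.pi / 3))) atTop (𝓝 0) := by
  refine Metric.tendsto_atTop.2 fun ε hε => ?_
  obtain ⟨K, hK⟩ := cutAsymptotic_vonNeumannBits ε hε
  refine ⟨K, fun n hn => ?_⟩
  have h := hK n n n (two_mul n).symm hn hn
  -- for `n = 0` the left side is `0` by the convention `0 / 0 = 0`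
  have h1 : (n : ℝ) * (2 * n - n) / n = n := by
    rw [two_mul, add_sub_cancel_right, mul_self_div_self]
  simp only [h1] at h
  rwa [Real.dist_eq, sub_zero]

end

theorem mainTheorem4 :
    -- von Neumann entropy: the exact sum, the asymptotic formula in nats and in bits
    (∀ n n₁ n₂ : ℕ, n₁ + n₂ = 2 * n →
      vonNeumannNats (rhoCut n₁ n₂) =
        -∑ m ∈ Finset.range (min n₁ n₂ + 1),
          schmidtProb n₁ n₂ m * Real.log (schmidtProb n₁ n₂ m)) ∧
    CutAsymptotic (fun n₁ n₂ => vonNeumannNats (rhoCut n₁ n₂))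
      (fun n n₁ => 1 / 2 * Real.log ((n₁ : ℝ) * (2 * n - n₁) / n)
        + Real.eulerMascheroniConstant - 1 / 2 + 1 / 2 * Real.log (2 * Real.pi / 3)) ∧
    CutAsymptotic (fun n₁ n₂ => vonNeumannBits (rhoCut n₁ n₂))
      (fun n n₁ => 1 / 2 * Real.logb 2 ((n₁ : ℝ) * (2 * n - n₁) / n)
        + (Real.eulerMascheroniConstant - 1 / 2) * Real.logb 2 (Real.exp 1)
        + 1 / 2 * Real.logb 2 (2 * Real.pi / 3)) ∧
    -- Rényi entropies: the exact sum, the asymptotic formula in nats and in bits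
    (∀ κ : ℝ, 0 < κ → κ ≠ 1 →
      (∀ n n₁ n₂ : ℕ, n₁ + n₂ = 2 * n →
        renyiNats κ (rhoCut n₁ n₂) =
          1 / (1 - κ) * Real.log (∑ m ∈ Finset.range (min n₁ n₂ + 1),
            schmidtProb n₁ n₂ m ^ κ)) ∧
      CutAsymptotic (fun n₁ n₂ => renyiNats κ (rhoCut n₁ n₂))
        (fun n n₁ => 1 / 2 * Real.log ((n₁ : ℝ) * (2 * n - n₁) / n) + renyiConst κ) ∧
      CutAsymptotic (fun n₁ n₂ => renyiBits κ (rhoCut n₁ n₂))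
        (fun n n₁ => 1 / 2 * Real.logb 2 ((n₁ : ℝ) * (2 * n - n₁) / n)
          + renyiConst κ * Real.logb 2 (Real.exp 1))) ∧
    -- the half-chain formula, in bits
    Filter.Tendsto (fun n : ℕ => vonNeumannBits (rhoCut n n) -
        (1 / 2 * Real.logb 2 n
          + (Real.eulerMascheroniConstant - 1 / 2) * Real.logb 2 (Real.exp 1)
          + 1 / 2 * Real.logb 2 (2 * Real.pi / 3)))
      Filter.atTop (nhds 0) := by
  refine ⟨fun n n₁ n₂ _ => ?_, cutAsymptotic_vonNeumannNats, cutAsymptotic_vonNeumannBits,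
    fun κ hκ hκ1 => ⟨fun n n₁ n₂ _ => renyiNats_rhoCut hκ n₁ n₂, cutAsymptotic_renyiNats hκ hκ1,
      cutAsymptotic_renyiBits hκ hκ1⟩, tendsto_half_chain⟩
  rw [vonNeumannNats_rhoCut, ← Finset.sum_neg_distrib]
  simp only [Real.negMulLog, neg_mul]
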